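/- **Theorem 2.1.** Let $K$ be a commutative unital ring. *Splittings.* For $I=(i_1<\dots<i_k)$ a splitting $I=A\sqcup B$ is a choice of a subset $B$ of the entries, with complement $A$. Let $\mathrm{inv}(A,B)$ be the number of pairs $a\in A$, $b\in B$ with $b<a$ (the number of inversions of the permutation listing $A$ and then $B$, both increasingly), and let $\widehat A$ be the increasing tuple of the numbers $a-\#\{b\in B: b<a\}$, $a\in A$. For families of maps $g=\{g_I\}$, $f=\{f_I\}$ put $$(g*f)_I=\sum_{I=A\sqcup B}(-1)^{\mathrm{inv}(A,B)}\,g_{\widehat A}\,f_B ,$$ the empty blocks being allowed. *The category $D\mathcal F(K)$.* A $D\mathcal F$-module consists of $K$-modules $X_{n,m}$, $n,m\ge 0$, of $K$-linear maps $t_n,r_n:X_{n,\bullet}\to X_{n,\bullet}$ with $t_n^{n+1}=1$, $r_n^2=1$, $r_nt_n=t_n^{-1}r_n$, and of a family $\partial=\{\partial_I:X_{n,\bullet}\to X_{n-k,\bullet+k-1}\}$, indexed by $I=(i_1<\dots<i_k)$, $0\le i_1$, $i_k\le n$, $0\le k\le n$, with $d:=\partial_{()}$ the differential, such that $\partial*\partial=0$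 and $$\partial_{(i_1,\dots,i_k)}t_n=\begin{cases}t_{n-k}\,\partial_{(i_1-1,\dots,i_k-1)},&k=0\text{ or }i_1>0,\\(-1)^{k-1}\partial_{(i_2-1,\dots,i_k-1,n)},&i_1=0,\end{cases}\qquad \partial_{(i_1,\dots,i_k)}r_n=(-1)^{k(k-1)/2}r_{n-k}\,\partial_{(n-i_k,\dots,n-i_1)} .$$ A morphism $f:X\to Y$ is a family $f_I:X_{n,\bullet}\to Y_{n-k,\bullet+k}$ satisfying the same two compatibilities with $t$ and $r$, and $\partial*f=f*\partial$. The composite of $f$ and $g$ is $g*f$; the identity has $(1_X)_{()}=\mathrm{id}$ and its other components are $0$. A homotopy between $f,g:X\to Y$ is a family $h_I:X_{n,\bullet}\to Y_{n-k,\bullet+k+1}$ satisfying the same compatibilities with $t$ and $r$, and $\partial*h+h*\partial=f-g$. A morphism $f:X\to Y$ is a homotopy equivalence if there is a morphism $g:Y\to X$ such that $gf$ and $fg$ are homotopic to the identities. *The cyclic bicomplex.* Let $\overline X_N=\bigoplus_{n+m=N}X_{n,m}$. For a family $f$ and $q\in\{0,1\}$ let $\overline f_q$ be the sum of the maps $(-1)^{i_1+\dots+i_k}f_{(i_1,\dots,i_k)}$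 on $X_{n,\bullet}$ over all $0\le i_1<\dots<i_k\le n-q$, $k\ge0$. Put $b=\overline\partial_0$, $b'=\overline\partial_1$; let $\overline T,\overline N,\overline R$ act on $X_{n,\bullet}$ as $T_n=(-1)^nt_n$, $N_n=1+T_n+\dots+T_n^n$, $R_n=(-1)^{n(n+1)/2}r_n$. The bicomplex $C(\overline X)$ has $C(\overline X)_{n,m}=\overline X_n$, $n,m\ge 0$, with $\delta_1=b$, $\delta_2=\overline N$ for $m$ even (and $\delta_2=0$ for $m=0$), and $\delta_1=-b'$, $\delta_2=1-\overline T$ for $m$ odd, where $\delta_1$ lowers $n$ and $\delta_2$ lowers $m$ by one. The group $\mathbb Z_2=\{1,\vartheta\}$ acts on it by $\vartheta=(-1)^k\overline R$ for $m=2k$ and $\vartheta=(-1)^{k+1}\overline R\,\overline T$ for $m=2k+1$. A morphism $f$ induces the $\mathbb Z_2$-equivariant map of bicomplexes $C(f)$, equal to $\overline f_0$ for $m$ even and to $\overline f_1$ for $m$ odd. *Dihedral homology.* $HD(X)$ is the homology of the total complex, with differential $\delta_1+\delta_2+\delta_3$, of the triple complex $D(\overline X)_{n,m,l}=C(\overline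 X)_{n,m}$, $n,m,l\ge0$, where $\delta_3=(-1)^{n+m}(1+(-1)^l\vartheta):D(\overline X)_{n,m,l}\to D(\overline X)_{n,m,l-1}$ for $l\ge1$; $HD(f):HD(X)\to HD(Y)$ is induced by $C(f)$. *Claim.* $HD$ is a functor from $D\mathcal F(K)$ to the category $GrM(K)$ of graded $K$-modules and $K$-linear maps of degree $0$. For every projective resolution $P$ of the trivial $K[\mathbb Z_2]$-module $K$ it is naturally isomorphic to the hyperhomology $H(\mathbb Z_2;C(\overline X))$, that is, to the homology of the total complex of $P\otimes_{K[\mathbb Z_2]}C(\overline X)$ with differential $\delta_1+\delta_2+\delta_3$, $\delta_3=(-1)^{n+m}d\otimes1$ on $P_l\otimes_{K[\mathbb Z_2]} C(\overline X)_{n,m}$. The functor $HD$ sends homotopy equivalences of $D\mathcal F$-modules to isomorphisms of graded modules. -/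

import Mathlib

open CategoryTheory

universe u

namespace Dihedral

/-- For a tuple whose first block has entry set `A` and whose last block has entry set `B`, the set
of entries of the first block after hatting: every `a` is lowered by the number of smaller entries
to its right. (The second block is sorted, so it is unchanged by hatting.) -/
def hat (A B : Finset ℕ) : Finset ℕ := A.image fun a => a - (B.filter (· < a)).card

/-- The number of inversions of the permutation that lists the increasing block `A` first and the
increasing block `B` afterwards. -/
def inversions (A B : Finset ℕ) : ℕ := ∑ a ∈ A, (B.filter (· < a)).card

/-- The cyclic shift `i ↦ i - 1`, `0 ↦ n` of `{0, …, n}`. -/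
def rot (n i : ℕ) : ℕ := if i = 0 then n else i - 1

section Combinatorics

/-- the individual hatting map -/
def low (B : Finset ℕ) (a : ℕ) : ℕ := a - (B.filter (· < a)).card

theorem hat_def (A B : Finset ℕ) : hat A B = A.image (low B) := rfl

theorem card_filter_lt_le (B : Finset ℕ) (a : ℕ) : (B.filter (· < a)).card ≤ a := by
  calc (B.filter (· < a)).card ≤ (Finset.range a).card :=
        Finset.card_le_card (fun x hx => by simp at hx ⊢; exact hx.2)
    _ = a := by simp

theorem low_add (B : Finset ℕ) (a : ℕ) : low B a + (B.filter (· < a)).card = a :=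
  Nat.sub_add_cancel (card_filter_lt_le B a)

theorem low_lt {B : Finset ℕ} {a b : ℕ} (ha : a ∉ B) (hab : a < b) : low B a < low B b := by
  have h1 := low_add B a
  have h2 := low_add B b
  have h3 : (B.filter (· < b)).card ≤ (B.filter (· < a)).card + (b - a - 1) := by
    have : B.filter (· < b) ⊆ B.filter (· < a) ∪ Finset.Ioo a b := by
      intro x hx
      simp at hx ⊢
      rcases lt_trichotomy x a with h | h | h
      · exact Or.inl ⟨hx.1, h⟩
      · subst h; exact absurd hx.1 ha
      · exact Or.inr ⟨h, hx.2⟩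
    calc _ ≤ _ := Finset.card_le_card this
      _ ≤ _ := Finset.card_union_le _ _
      _ = _ := by simp
  omega

theorem low_lt_iff {B : Finset ℕ} {a b : ℕ} (ha : a ∉ B) (hb : b ∉ B) :
    low B a < low B b ↔ a < b := by
  refine ⟨fun h => ?_, low_lt ha⟩
  by_contra hab
  rcases Nat.lt_or_eq_of_le (not_lt.mp hab) with h' | h'
  · exact absurd (low_lt hb h') (by omega)
  · subst h'; omega

theorem low_inj {B : Finset ℕ} {a b : ℕ} (ha : a ∉ B) (hb : b ∉ B) (h : low B a = low B b) :
    a = b := by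
  rcases lt_trichotomy a b with h' | h' | h'
  · exact absurd (low_lt ha h') (by omega)
  · exact h'
  · exact absurd (low_lt hb h') (by omega)

theorem low_injOn {A B : Finset ℕ} (h : Disjoint A B) : Set.InjOn (low B) A :=
  fun _ ha _ hb hab => low_inj (Finset.disjoint_left.mp h ha) (Finset.disjoint_left.mp h hb) hab

theorem card_hat {A B : Finset ℕ} (h : Disjoint A B) : (hat A B).card = A.card :=
  Finset.card_image_of_injOn (low_injOn h)

theorem card_filter_hat {B D : Finset ℕ} (h : Disjoint D B) {a : ℕ} (ha : a ∉ B) :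
    ((hat D B).filter (· < low B a)).card = (D.filter (· < a)).card := by
  have : (hat D B).filter (· < low B a) = hat (D.filter (· < a)) B := by
    ext x
    simp only [hat_def, Finset.mem_filter, Finset.mem_image]
    constructor
    · rintro ⟨⟨d, hd, rfl⟩, hlt⟩
      exact ⟨d, ⟨hd, (low_lt_iff (Finset.disjoint_left.mp h hd) ha).1 hlt⟩, rfl⟩
    · rintro ⟨d, ⟨hd, hlt⟩, rfl⟩
      exact ⟨⟨d, hd, rfl⟩, low_lt (Finset.disjoint_left.mp h hd) hlt⟩
  rw [this, card_hat (h.mono_left (Finset.filter_subset _ _))]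

theorem low_low {B D : Finset ℕ} (h : Disjoint D B) {a : ℕ} (ha : a ∉ B) :
    low (hat D B) (low B a) = low (B ∪ D) a := by
  have h1 := low_add B a
  have h2 := low_add (hat D B) (low B a)
  have h3 := low_add (B ∪ D) a
  rw [card_filter_hat h ha] at h2
  rw [Finset.filter_union, Finset.card_union_of_disjoint
    (Finset.disjoint_filter_filter h.symm)] at h3
  omega

theorem hat_hat {B D F : Finset ℕ} (h : Disjoint D B) (hF : Disjoint F B) :
    hat (hat F B) (hat D B) = hat F (B ∪ D) := by
  simp only [hat_def, Finset.image_image]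
  refine Finset.image_congr fun a ha => ?_
  exact low_low h (Finset.disjoint_left.mp hF ha)

theorem inversions_hat {B D F : Finset ℕ} (h : Disjoint D B) (hF : Disjoint F B) :
    inversions (hat F B) (hat D B) = inversions F D := by
  unfold inversions
  rw [hat_def, Finset.sum_image (low_injOn hF)]
  exact Finset.sum_congr rfl fun a ha => card_filter_hat h (Finset.disjoint_left.mp hF ha)

theorem inversions_union_right (A : Finset ℕ) {B C : Finset ℕ} (h : Disjoint B C) :
    inversions A (B ∪ C) = inversions A B + inversions A C := by
  unfold inversions
  rw [← Finset.sum_add_distrib]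
  refine Finset.sum_congr rfl fun a _ => ?_
  rw [Finset.filter_union, Finset.card_union_of_disjoint (Finset.disjoint_filter_filter h)]

theorem inversions_union_left {A B : Finset ℕ} (C : Finset ℕ) (h : Disjoint A B) :
    inversions (A ∪ B) C = inversions A C + inversions B C := Finset.sum_union h

theorem hat_union (A B C : Finset ℕ) : hat (A ∪ B) C = hat A C ∪ hat B C :=
  Finset.image_union _ _

theorem hat_empty_right (A : Finset ℕ) : hat A ∅ = A := by
  simp [hat]

theorem hat_empty_left (A : Finset ℕ) : hat ∅ A = ∅ := by
  simp [hat]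

theorem hat_range {M : ℕ} {B : Finset ℕ} (hB : B ⊆ Finset.range M) :
    hat (Finset.range M \ B) B = Finset.range (M - B.card) := by
  have hd : Disjoint (Finset.range M \ B) B := Finset.sdiff_disjoint
  refine Finset.eq_of_subset_of_card_le ?_ ?_
  · intro x hx
    simp only [hat_def, Finset.mem_image, Finset.mem_sdiff, Finset.mem_range] at hx
    obtain ⟨a, ⟨ha, haB⟩, rfl⟩ := hx
    have h1 := low_add B a
    have h2 : B.card ≤ (B.filter (· < a)).card + (M - a - 1) := by
      have : B ⊆ B.filter (· < a) ∪ Finset.Ioo a M := by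
        intro x hx
        have hxM := Finset.mem_range.mp (hB hx)
        simp only [Finset.mem_union, Finset.mem_filter, Finset.mem_Ioo]
        rcases lt_trichotomy x a with h | h | h
        · exact Or.inl ⟨hx, h⟩
        · subst h; exact absurd hx haB
        · exact Or.inr ⟨h, hxM⟩
      calc _ ≤ _ := Finset.card_le_card this
        _ ≤ _ := Finset.card_union_le _ _
        _ = _ := by simp
    simp only [Finset.mem_range]
    have : (B.filter (· < a)).card ≤ B.card := Finset.card_filter_le _ _
    omega
  · rw [card_hat hd, Finset.card_sdiff_of_subset hB]
    simp

theorem sum_hat {A B : Finset ℕ} (h : Disjoint A B) :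
    (∑ a ∈ hat A B, a) + inversions A B = ∑ a ∈ A, a := by
  rw [hat_def, Finset.sum_image (low_injOn h)]
  unfold inversions
  rw [← Finset.sum_add_distrib]
  exact Finset.sum_congr rfl fun a _ => low_add B a

/-- Splitting a set twice. -/
theorem sum_powerset_powerset {M : Type*} [AddCommMonoid M] (S : Finset ℕ)
    (φ : Finset ℕ → Finset ℕ → M) :
    ∑ C ∈ S.powerset, ∑ B ∈ C.powerset, φ B (C \ B) =
      ∑ B ∈ S.powerset, ∑ D ∈ (S \ B).powerset, φ B D := by
  rw [Finset.sum_sigma', Finset.sum_sigma']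
  refine Finset.sum_bij' (fun p _ => ⟨p.2, p.1 \ p.2⟩) (fun p _ => ⟨p.1 ∪ p.2, p.1⟩) ?_ ?_ ?_ ?_ ?_
  · rintro ⟨C, B⟩ h
    simp only [Finset.mem_sigma, Finset.mem_powerset] at h ⊢
    exact ⟨h.2.trans h.1, Finset.sdiff_subset_sdiff h.1 le_rfl⟩
  · rintro ⟨B, D⟩ h
    simp only [Finset.mem_sigma, Finset.mem_powerset] at h ⊢
    exact ⟨Finset.union_subset h.1 (h.2.trans Finset.sdiff_subset), Finset.subset_union_left⟩
  · rintro ⟨C, B⟩ h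
    simp only [Finset.mem_sigma, Finset.mem_powerset] at h ⊢
    simp [Finset.union_sdiff_of_subset h.2]
  · rintro ⟨B, D⟩ h
    simp only [Finset.mem_sigma, Finset.mem_powerset] at h ⊢
    have hd : Disjoint D B := Finset.disjoint_of_subset_left h.2 Finset.sdiff_disjoint
    simp [Finset.union_sdiff_cancel_left hd.symm]
  · rintro ⟨C, B⟩ h
    rfl

theorem powerset_image_injOn {α β : Type*} [DecidableEq α] [DecidableEq β] {f : α → β} {S : Finset α}
    (h : Set.InjOn f S) : Set.InjOn (fun B : Finset α => B.image f) (S.powerset : Set (Finset α)) := by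
  intro B hB C hC hBC
  simp only [Finset.coe_powerset, Set.mem_preimage, Set.mem_powerset_iff, Finset.coe_subset] at hB hC
  exact (Finset.image_injOn_powerset_of_injOn h (by simpa using hB) (by simpa using hC) hBC)

/-- Reindexing a sum over subsets along a map that is injective on the given set. -/
theorem sum_powerset_image {M : Type*} [AddCommMonoid M] {f : ℕ → ℕ} {S : Finset ℕ}
    (h : Set.InjOn f S) (φ : Finset ℕ → M) :
    ∑ E ∈ (S.image f).powerset, φ E = ∑ D ∈ S.powerset, φ (D.image f) := by
  rw [Finset.powerset_image, Finset.sum_image (powerset_image_injOn h)]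

end Combinatorics

/-- A bigraded `K`-module `X_{n,m}`, `n, m ≥ 0`, with operators `t_n` and `r_n` of bidegree `(0,0)`
that satisfy the dihedral relations `t_n^{n+1} = 1`, `r_n² = 1`, `r_n t_n = t_n⁻¹ r_n`
(the last one is written as `t_n r_n t_n = r_n`). -/
structure DihedralBigraded (K : Type u) [CommRing K] where
  /-- the module in bidegree `(n, m)` -/
  X : ℕ → ℕ → Type u
  [addCommGroup : ∀ n m, AddCommGroup (X n m)]
  [module : ∀ n m, Module K (X n m)]
  /-- the cyclic operator -/
  t : ∀ n m, X n m →ₗ[K] X n m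
  /-- the reflection -/
  r : ∀ n m, X n m →ₗ[K] X n m
  t_pow : ∀ n m, t n m ^ (n + 1) = 1
  r_r : ∀ n m, r n m ∘ₗ r n m = LinearMap.id
  t_r_t : ∀ n m, t n m ∘ₗ r n m ∘ₗ t n m = r n m

attribute [instance] DihedralBigraded.addCommGroup DihedralBigraded.module

variable {K : Type u} [CommRing K]

/-- A family of linear maps `f_S : X_{n,m} → Y_{n',m'}`; the finite set `S = {i_1 < … < i_k}` stands
for the tuple `(i_1, …, i_k)`. -/
abbrev Family (X Y : DihedralBigraded.{u} K) : Type u :=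
  ∀ (n m n' m' : ℕ), Finset ℕ → X.X n m →ₗ[K] Y.X n' m'

/-- The family has total degree `c`: `f_{(i_1,…,i_k)}` is only present for
`0 ≤ i_1 < … < i_k ≤ n`, `k ≤ n`, and then maps `X_{n,m}` to `Y_{n-k,m+k+c}`. All other entries of
the family are zero. -/
def HasDegree {X Y : DihedralBigraded.{u} K} (c : ℤ) (f : Family X Y) : Prop :=
  ∀ n m n' m' S, f n m n' m' S ≠ 0 →
    S ⊆ Finset.range (n + 1) ∧ n' + S.card = n ∧ (m' : ℤ) = m + S.card + c

/-- Compatibility of a family with the operators `t` and `r`. -/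
structure IsDihedral {X Y : DihedralBigraded.{u} K} (f : Family X Y) : Prop where
  comp_t_of_notMem : ∀ n m n' m' S, S ⊆ Finset.range (n + 1) → 0 ∉ S →
    f n m n' m' S ∘ₗ X.t n m = Y.t n' m' ∘ₗ f n m n' m' (S.image (rot n))
  comp_t_of_mem : ∀ n m n' m' S, S ⊆ Finset.range (n + 1) → 0 ∈ S →
    f n m n' m' S ∘ₗ X.t n m = (-1 : K) ^ (S.card - 1) • f n m n' m' (S.image (rot n))
  comp_r : ∀ n m n' m' S, S ⊆ Finset.range (n + 1) →
    f n m n' m' S ∘ₗ X.r n m =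
      (-1 : K) ^ (S.card * (S.card - 1) / 2) • (Y.r n' m' ∘ₗ f n m n' m' (S.image (n - ·)))

/-- The shuffle product of families, `∑ (-1)^{sign σ} g_{hat(i_σ(1)…i_σ(p))} f_{(i_σ(p+1)…i_σ(k))}`;
the sum runs over all ways to split the tuple into two increasing blocks: `B` is the set of entries
of the last block and `S \ B` that of the first one. Here `c` is the degree of `f`. -/
def shuffle {X Y Z : DihedralBigraded.{u} K} (c : ℤ) (g : Family Y Z) (f : Family X Y) :
    Family X Z := fun n m n' m' S =>
  ∑ B ∈ S.powerset, (-1 : K) ^ inversions (S \ B) B •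
    (g (n - B.card) (m + B.card + c).toNat n' m' (hat (S \ B) B) ∘ₗ
      f n m (n - B.card) (m + B.card + c).toNat B)

section Lemmas

theorem sum_comp' {M N P ι : Type*} [AddCommGroup M] [AddCommGroup N] [AddCommGroup P] [Module K M]
    [Module K N] [Module K P] (s : Finset ι) (g : ι → N →ₗ[K] P) (f : M →ₗ[K] N) :
    (∑ i ∈ s, g i) ∘ₗ f = ∑ i ∈ s, g i ∘ₗ f := by
  ext x; simp

theorem comp_sum' {M N P ι : Type*} [AddCommGroup M] [AddCommGroup N] [AddCommGroup P] [Module K M]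
    [Module K N] [Module K P] (s : Finset ι) (g : N →ₗ[K] P) (f : ι → M →ₗ[K] N) :
    g ∘ₗ (∑ i ∈ s, f i) = ∑ i ∈ s, g ∘ₗ f i := by
  ext x; simp

variable {X Y Z W : DihedralBigraded.{u} K}

theorem HasDegree.eq_zero {c : ℤ} {f : Family X Y} (hf : HasDegree c f) {n m n' m' : ℕ}
    {S : Finset ℕ} (h : ¬ (S ⊆ Finset.range (n + 1) ∧ n' + S.card = n ∧
      (m' : ℤ) = m + S.card + c)) : f n m n' m' S = 0 := by
  by_contra h'
  exact h (hf _ _ _ _ _ h')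

theorem HasDegree.shuffle {c d e : ℤ} {f : Family X Y} {g : Family Y Z} (hf : HasDegree c f)
    (hg : HasDegree d g) (he : c + d = e) : HasDegree e (shuffle c g f) := by
  intro n m n' m' S h
  obtain ⟨B, hB, h'⟩ := Finset.exists_ne_zero_of_sum_ne_zero h
  have hBS := Finset.mem_powerset.mp hB
  have hfB : f n m (n - B.card) (m + B.card + c).toNat B ≠ 0 := by
    intro h0
    rw [h0] at h'
    simp at h'
  have hgB : g (n - B.card) (m + B.card + c).toNat n' m' (hat (S \ B) B) ≠ 0 := by
    intro h0
    rw [h0] at h'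
    simp at h'
  obtain ⟨h1, h2, h3⟩ := hf _ _ _ _ _ hfB
  obtain ⟨h4, h5, h6⟩ := hg _ _ _ _ _ hgB
  rw [card_hat Finset.sdiff_disjoint] at h5 h6
  have hc := Finset.card_sdiff_add_card_eq_card hBS
  refine ⟨?_, by omega, by omega⟩
  intro a ha
  by_cases haB : a ∈ B
  · exact h1 haB
  · have : low B a ∈ hat (S \ B) B :=
      Finset.mem_image_of_mem _ (Finset.mem_sdiff.mpr ⟨ha, haB⟩)
    have h7 := Finset.mem_range.mp (h4 this)
    have h8 := low_add B a
    have h9 : (B.filter (· < a)).card ≤ B.card := Finset.card_filter_le _ _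
    simp only [Finset.mem_range]
    omega

theorem shuffle_assoc {c d : ℤ} {f : Family X Y} {g : Family Y Z} (h : Family Z W)
    (hf : HasDegree c f) :
    shuffle c (shuffle d h g) f = shuffle (c + d) h (shuffle c g f) := by
  funext n m n' m' S
  simp only [shuffle]
  have key : ∀ B ∈ S.powerset, ∀ D ∈ (S \ B).powerset,
      (-1 : K) ^ inversions (S \ B) B • (((-1 : K) ^ inversions (hat (S \ B) B \ hat D B) (hat D B) •
        (h (n - B.card - (hat D B).card) (((m + B.card + c).toNat + (hat D B).card + d : ℤ)).toNat
          n' m' (hat (hat (S \ B) B \ hat D B) (hat D B)) ∘ₗ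
          g (n - B.card) (m + B.card + c).toNat _ _ (hat D B))) ∘ₗ
            f n m (n - B.card) (m + B.card + c).toNat B) =
      (-1 : K) ^ inversions (S \ (B ∪ D)) (B ∪ D) •
        (h (n - (B ∪ D).card) (m + (B ∪ D).card + (c + d)).toNat n' m'
          (hat (S \ (B ∪ D)) (B ∪ D)) ∘ₗ ((-1 : K) ^ inversions D B •
            (g (n - B.card) (m + B.card + c).toNat _ _ (hat D B) ∘ₗ
              f n m (n - B.card) (m + B.card + c).toNat B))) := by
    intro B hB D hD
    rw [Finset.mem_powerset] at hB hD
    have hDB : Disjoint D B := Finset.disjoint_of_subset_left hD Finset.sdiff_disjoint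
    by_cases hz : f n m (n - B.card) (m + B.card + c).toNat B = 0
    · simp [hz]
    obtain ⟨h1, h2, h3⟩ := hf _ _ _ _ _ hz
    set F := S \ (B ∪ D) with hF
    have hFB : Disjoint F B :=
      Finset.disjoint_of_subset_right Finset.subset_union_left Finset.sdiff_disjoint
    have hFD : Disjoint F D :=
      Finset.disjoint_of_subset_right Finset.subset_union_right Finset.sdiff_disjoint
    have hS : S \ B = F ∪ D := by
      ext x
      have h1 := @hD x
      have h2 := @Finset.disjoint_left _ D B
      simp only [hF, Finset.mem_sdiff, Finset.mem_union] at h1 ⊢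
      tauto
    have hhat : hat (S \ B) B \ hat D B = hat F B := by
      rw [hS, hat_union]
      refine Finset.union_sdiff_cancel_right ?_
      rw [Finset.disjoint_left]
      intro x hx hx'
      simp only [hat_def, Finset.mem_image] at hx hx'
      obtain ⟨a, ha, rfl⟩ := hx
      obtain ⟨b, hb, hab⟩ := hx'
      have := low_inj (Finset.disjoint_left.mp hDB hb) (Finset.disjoint_left.mp hFB ha) hab
      subst this
      exact Finset.disjoint_left.mp hFD ha hb
    have hn : n - B.card - (hat D B).card = n - (B ∪ D).card := by
      rw [card_hat hDB, Finset.card_union_of_disjoint hDB.symm]; omega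
    have hm : (((m + B.card + c).toNat + (hat D B).card + d : ℤ)).toNat =
        (m + (B ∪ D).card + (c + d)).toNat := by
      rw [card_hat hDB, Finset.card_union_of_disjoint hDB.symm]; push_cast; omega
    rw [hhat, hat_hat hDB hFB, inversions_hat hDB hFB, hn, hm, hS,
      inversions_union_left B hFD, inversions_union_right F hDB.symm]
    simp only [LinearMap.smul_comp, LinearMap.comp_smul, smul_smul, LinearMap.comp_assoc, ← pow_add]
    congr 2
    ring
  calc _ = ∑ B ∈ S.powerset, ∑ D ∈ (S \ B).powerset, (-1 : K) ^ inversions (S \ (B ∪ D)) (B ∪ D) •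
        (h (n - (B ∪ D).card) (m + (B ∪ D).card + (c + d)).toNat n' m'
          (hat (S \ (B ∪ D)) (B ∪ D)) ∘ₗ ((-1 : K) ^ inversions D B •
            (g (n - B.card) (m + B.card + c).toNat _ _ (hat D B) ∘ₗ
              f n m (n - B.card) (m + B.card + c).toNat B))) := by
        refine Finset.sum_congr rfl fun B hB => ?_
        rw [hat_def, sum_powerset_image (low_injOn Finset.sdiff_disjoint), sum_comp',
          Finset.smul_sum]
        exact Finset.sum_congr rfl fun D hD => key B hB D hD
    _ = _ := by
        rw [← sum_powerset_powerset S (fun B D => (-1 : K) ^ inversions (S \ (B ∪ D)) (B ∪ D) •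
        (h (n - (B ∪ D).card) (m + (B ∪ D).card + (c + d)).toNat n' m'
          (hat (S \ (B ∪ D)) (B ∪ D)) ∘ₗ ((-1 : K) ^ inversions D B •
            (g (n - B.card) (m + B.card + c).toNat _ _ (hat D B) ∘ₗ
              f n m (n - B.card) (m + B.card + c).toNat B))))]
        refine Finset.sum_congr rfl fun C hC => ?_
        rw [comp_sum', Finset.smul_sum]
        refine Finset.sum_congr rfl fun B hB => ?_
        rw [Finset.union_sdiff_of_subset (Finset.mem_powerset.mp hB)]

end Lemmas

section Lemmas

theorem sgn_eq {p q : ℕ} (h : p % 2 = q % 2) : (-1 : K) ^ p = (-1) ^ q := by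
  rw [neg_one_pow_eq_pow_mod_two, h, ← neg_one_pow_eq_pow_mod_two]

theorem rot_injOn (n : ℕ) : Set.InjOn (rot n) (Finset.range (n + 1) : Finset ℕ) := by
  intro a ha b hb h
  simp only [Finset.coe_range, Set.mem_Iio] at ha hb
  simp only [rot] at h
  split_ifs at h <;> omega

theorem rot_image_subset {n : ℕ} {S : Finset ℕ} (hS : S ⊆ Finset.range (n + 1)) :
    S.image (rot n) ⊆ Finset.range (n + 1) := by
  intro x hx
  obtain ⟨a, ha, rfl⟩ := Finset.mem_image.mp hx
  have := Finset.mem_range.mp (hS ha)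
  simp only [rot, Finset.mem_range]
  split_ifs <;> omega

theorem rot_injOn' {n : ℕ} {S : Finset ℕ} (hS : S ⊆ Finset.range (n + 1)) :
    Set.InjOn (rot n) S := (rot_injOn n).mono (Finset.coe_subset.mpr hS)

theorem card_image_rot {n : ℕ} {S : Finset ℕ} (hS : S ⊆ Finset.range (n + 1)) :
    (S.image (rot n)).card = S.card := Finset.card_image_of_injOn (rot_injOn' hS)

theorem image_rot_sdiff {n : ℕ} {S B : Finset ℕ} (hS : S ⊆ Finset.range (n + 1)) (hB : B ⊆ S) :
    S.image (rot n) \ B.image (rot n) = (S \ B).image (rot n) :=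
  (Finset.image_sdiff_of_injOn (rot_injOn' hS) hB).symm

theorem card_filter_rot {n : ℕ} {B : Finset ℕ} (hB : B ⊆ Finset.range (n + 1)) {a : ℕ}
    (ha : a ≠ 0) (han : a ≤ n) :
    ((B.image (rot n)).filter (· < rot n a)).card =
      ((B.filter (· < a)).erase 0).card := by
  rw [Finset.filter_image, Finset.card_image_of_injOn
    ((rot_injOn' hB).mono (Finset.coe_subset.mpr (Finset.filter_subset _ _)))]
  congr 1
  ext b
  simp only [Finset.mem_filter, Finset.mem_erase, rot, ha, if_false]
  constructor
  · rintro ⟨h1, h2⟩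
    split_ifs at h2 with h
    · omega
    · exact ⟨h, h1, by omega⟩
  · rintro ⟨h0, h1, h2⟩
    rw [if_neg h0]
    exact ⟨h1, by omega⟩

theorem card_filter_rot_zero {n : ℕ} {B : Finset ℕ} (hB : B ⊆ Finset.range (n + 1))
    (h0 : 0 ∉ B) :
    ((B.image (rot n)).filter (· < rot n 0)).card = B.card := by
  rw [Finset.filter_true_of_mem, card_image_rot hB]
  intro x hx
  obtain ⟨a, ha, rfl⟩ := Finset.mem_image.mp hx
  have := Finset.mem_range.mp (hB ha)
  have h1 : a ≠ 0 := fun h => h0 (h ▸ ha)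
  simp only [rot, h1, if_true, if_false]
  omega

theorem low_rot_of_notMem {n : ℕ} {B : Finset ℕ} (hB : B ⊆ Finset.range (n + 1)) (h0 : 0 ∉ B)
    {a : ℕ} (han : a ≤ n) (ha : a ∉ B) :
    low (B.image (rot n)) (rot n a) = rot (n - B.card) (low B a) := by
  by_cases ha0 : a = 0
  · subst ha0
    unfold low
    rw [card_filter_rot_zero hB h0]
    simp [rot]
  · have h1 := card_filter_rot hB ha0 han
    rw [Finset.erase_eq_of_notMem (fun h => h0 (Finset.mem_filter.mp h).1)] at h1
    have h2 : low B 0 < low B a := low_lt h0 (by omega)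
    have h3 := low_add B a
    unfold low at h2 h3 ⊢
    rw [h1]
    simp only [rot]
    rw [if_neg ha0, if_neg (by omega)]
    omega

theorem low_rot_of_mem {n : ℕ} {B : Finset ℕ} (hB : B ⊆ Finset.range (n + 1)) (h0 : 0 ∈ B)
    {a : ℕ} (han : a ≤ n) (ha : a ∉ B) :
    low (B.image (rot n)) (rot n a) = low B a := by
  have ha0 : a ≠ 0 := fun h => ha (h ▸ h0)
  have h1 := card_filter_rot hB ha0 han
  have h4 : 0 ∈ B.filter (· < a) := Finset.mem_filter.mpr ⟨h0, by omega⟩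
  rw [Finset.card_erase_of_mem h4] at h1
  have h5 := Finset.card_pos.mpr ⟨0, h4⟩
  have h3 := low_add B a
  unfold low at h3 ⊢
  rw [h1]
  simp only [rot]
  rw [if_neg ha0]
  omega

theorem hat_rot_of_notMem {n : ℕ} {A B : Finset ℕ} (hA : A ⊆ Finset.range (n + 1))
    (hB : B ⊆ Finset.range (n + 1)) (hd : Disjoint A B) (h0 : 0 ∉ B) :
    hat (A.image (rot n)) (B.image (rot n)) = (hat A B).image (rot (n - B.card)) := by
  simp only [hat_def, Finset.image_image]
  refine Finset.image_congr fun a ha => ?_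
  exact low_rot_of_notMem hB h0 (by have := Finset.mem_range.mp (hA ha); omega)
    (Finset.disjoint_left.mp hd ha)

theorem hat_rot_of_mem {n : ℕ} {A B : Finset ℕ} (hA : A ⊆ Finset.range (n + 1))
    (hB : B ⊆ Finset.range (n + 1)) (hd : Disjoint A B) (h0 : 0 ∈ B) :
    hat (A.image (rot n)) (B.image (rot n)) = hat A B := by
  simp only [hat_def, Finset.image_image]
  refine Finset.image_congr fun a ha => ?_
  exact low_rot_of_mem hB h0 (by have := Finset.mem_range.mp (hA ha); omega)
    (Finset.disjoint_left.mp hd ha)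

theorem inversions_rot_of_notMem {n : ℕ} {A B : Finset ℕ} (hA : A ⊆ Finset.range (n + 1))
    (hB : B ⊆ Finset.range (n + 1)) (h0 : 0 ∉ B) :
    inversions (A.image (rot n)) (B.image (rot n)) =
      inversions A B + if 0 ∈ A then B.card else 0 := by
  unfold inversions
  rw [Finset.sum_image (rot_injOn' hA)]
  have : (if 0 ∈ A then B.card else 0) = ∑ a ∈ A, if 0 = a then B.card else 0 := by
    rw [Finset.sum_ite_eq]
  rw [this, ← Finset.sum_add_distrib]
  refine Finset.sum_congr rfl fun a ha => ?_
  by_cases ha0 : a = 0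
  · subst ha0
    rw [card_filter_rot_zero hB h0]
    simp
  · rw [card_filter_rot hB ha0 (by have := Finset.mem_range.mp (hA ha); omega),
      Finset.erase_eq_of_notMem (fun h => h0 (Finset.mem_filter.mp h).1), if_neg (Ne.symm ha0)]
    simp

theorem inversions_rot_of_mem {n : ℕ} {A B : Finset ℕ} (hA : A ⊆ Finset.range (n + 1))
    (hB : B ⊆ Finset.range (n + 1)) (hd : Disjoint A B) (h0 : 0 ∈ B) :
    inversions (A.image (rot n)) (B.image (rot n)) + A.card = inversions A B := by
  unfold inversions
  rw [Finset.sum_image (rot_injOn' hA), Finset.card_eq_sum_ones, ← Finset.sum_add_distrib]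
  refine Finset.sum_congr rfl fun a ha => ?_
  have ha0 : a ≠ 0 := fun h => Finset.disjoint_left.mp hd ha (h ▸ h0)
  have h4 : 0 ∈ B.filter (· < a) := Finset.mem_filter.mpr ⟨h0, by omega⟩
  rw [card_filter_rot hB ha0 (by have := Finset.mem_range.mp (hA ha); omega),
    Finset.card_erase_of_mem h4]
  have h5 := Finset.card_pos.mpr ⟨0, h4⟩
  omega

theorem hat_subset {n : ℕ} {A B : Finset ℕ} (hA : A ⊆ Finset.range (n + 1))
    (hB : B ⊆ Finset.range (n + 1)) (hd : Disjoint A B) :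
    hat A B ⊆ Finset.range (n + 1 - B.card) := by
  rw [← hat_range hB]
  refine Finset.image_subset_image fun a ha => ?_
  exact Finset.mem_sdiff.mpr ⟨hA ha, Finset.disjoint_left.mp hd ha⟩

theorem zero_mem_hat {A B : Finset ℕ} (hd : Disjoint A B) (h0 : 0 ∉ B) : 0 ∈ hat A B ↔ 0 ∈ A := by
  have h00 : low B 0 = 0 := by simp [low]
  simp only [hat_def, Finset.mem_image]
  constructor
  · rintro ⟨a, ha, h⟩
    have : a = 0 := low_inj (Finset.disjoint_left.mp hd ha) h0 (h.trans h00.symm)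
    exact this ▸ ha
  · intro h
    exact ⟨0, h, h00⟩

variable {X Y Z : DihedralBigraded.{u} K}

theorem shuffle_comp_t_of_notMem {c : ℤ} {f : Family X Y} {g : Family Y Z} (hf : IsDihedral f)
    (hg : IsDihedral g) (hfc : HasDegree c f) (n m n' m' : ℕ) (S : Finset ℕ)
    (hS : S ⊆ Finset.range (n + 1)) (h0 : 0 ∉ S) :
    shuffle c g f n m n' m' S ∘ₗ X.t n m =
      Z.t n' m' ∘ₗ shuffle c g f n m n' m' (S.image (rot n)) := by
  simp only [shuffle]
  rw [sum_comp', comp_sum', sum_powerset_image (rot_injOn' hS)]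
  refine Finset.sum_congr rfl fun B hB => ?_
  have hBS := Finset.mem_powerset.mp hB
  have hBn := hBS.trans hS
  have hAn : S \ B ⊆ Finset.range (n + 1) := Finset.sdiff_subset.trans hS
  have hd : Disjoint (S \ B) B := Finset.sdiff_disjoint
  have h0B : 0 ∉ B := fun h => h0 (hBS h)
  have h0A : 0 ∉ S \ B := fun h => h0 (Finset.sdiff_subset h)
  rw [image_rot_sdiff hS hBS, card_image_rot hBn, inversions_rot_of_notMem hAn hBn h0B, if_neg h0A,
    add_zero, hat_rot_of_notMem hAn hBn hd h0B]
  simp only [LinearMap.smul_comp, LinearMap.comp_smul, LinearMap.comp_assoc]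
  congr 1
  by_cases hz : f n m (n - B.card) (m + B.card + c).toNat (B.image (rot n)) = 0
  · rw [hf.comp_t_of_notMem _ _ _ _ _ hBn h0B, hz]; simp
  obtain ⟨-, h2, -⟩ := hfc _ _ _ _ _ hz
  rw [card_image_rot hBn] at h2
  have hh : hat (S \ B) B ⊆ Finset.range (n - B.card + 1) :=
    (hat_subset hAn hBn hd).trans (Finset.range_subset_range.mpr (by omega))
  rw [hf.comp_t_of_notMem _ _ _ _ _ hBn h0B, ← LinearMap.comp_assoc,
    hg.comp_t_of_notMem _ _ _ _ _ hh (by rw [zero_mem_hat hd h0B]; exact h0A),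
    LinearMap.comp_assoc]

theorem shuffle_comp_t_of_mem {c : ℤ} {f : Family X Y} {g : Family Y Z} (hf : IsDihedral f)
    (hg : IsDihedral g) (hfc : HasDegree c f) (n m n' m' : ℕ) (S : Finset ℕ)
    (hS : S ⊆ Finset.range (n + 1)) (h0 : 0 ∈ S) :
    shuffle c g f n m n' m' S ∘ₗ X.t n m =
      (-1 : K) ^ (S.card - 1) • shuffle c g f n m n' m' (S.image (rot n)) := by
  simp only [shuffle]
  rw [sum_comp', sum_powerset_image (rot_injOn' hS), Finset.smul_sum]
  refine Finset.sum_congr rfl fun B hB => ?_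
  have hBS := Finset.mem_powerset.mp hB
  have hBn := hBS.trans hS
  have hAn : S \ B ⊆ Finset.range (n + 1) := Finset.sdiff_subset.trans hS
  have hd : Disjoint (S \ B) B := Finset.sdiff_disjoint
  have hcard := Finset.card_sdiff_add_card_eq_card hBS
  have hSpos := Finset.card_pos.mpr ⟨0, h0⟩
  rw [image_rot_sdiff hS hBS, card_image_rot hBn]
  by_cases h0B : 0 ∈ B
  · have hBpos := Finset.card_pos.mpr ⟨0, h0B⟩
    have hinv := inversions_rot_of_mem hAn hBn hd h0B
    rw [hat_rot_of_mem hAn hBn hd h0B, LinearMap.smul_comp, LinearMap.comp_assoc,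
      hf.comp_t_of_mem _ _ _ _ _ hBn h0B]
    simp only [LinearMap.comp_smul, smul_smul, ← pow_add]
    congr 1
    exact sgn_eq (by omega)
  · have h0A : 0 ∈ S \ B := Finset.mem_sdiff.mpr ⟨h0, h0B⟩
    rw [inversions_rot_of_notMem hAn hBn h0B, if_pos h0A, hat_rot_of_notMem hAn hBn hd h0B]
    rw [LinearMap.smul_comp, LinearMap.comp_assoc, hf.comp_t_of_notMem _ _ _ _ _ hBn h0B]
    by_cases hz : f n m (n - B.card) (m + B.card + c).toNat (B.image (rot n)) = 0
    · rw [hz]; simp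
    obtain ⟨-, h2, -⟩ := hfc _ _ _ _ _ hz
    rw [card_image_rot hBn] at h2
    have hh : hat (S \ B) B ⊆ Finset.range (n - B.card + 1) :=
      (hat_subset hAn hBn hd).trans (Finset.range_subset_range.mpr (by omega))
    rw [← LinearMap.comp_assoc,
      hg.comp_t_of_mem _ _ _ _ _ hh (by rw [zero_mem_hat hd h0B]; exact h0A), card_hat hd]
    have hApos := Finset.card_pos.mpr ⟨0, h0A⟩
    simp only [LinearMap.smul_comp, smul_smul, ← pow_add]
    congr 1
    exact sgn_eq (by omega)

theorem refl_injOn {n : ℕ} {S : Finset ℕ} (hS : S ⊆ Finset.range (n + 1)) :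
    Set.InjOn (n - ·) (S : Set ℕ) := by
  intro a ha b hb h
  have h1 := Finset.mem_range.mp (hS ha)
  have h2 := Finset.mem_range.mp (hS hb)
  simp only at h
  omega

theorem card_image_refl {n : ℕ} {S : Finset ℕ} (hS : S ⊆ Finset.range (n + 1)) :
    (S.image (n - ·)).card = S.card := Finset.card_image_of_injOn (refl_injOn hS)

theorem card_filter_refl {n : ℕ} {B : Finset ℕ} (hB : B ⊆ Finset.range (n + 1)) {a : ℕ}
    (han : a ≤ n) (ha : a ∉ B) :
    ((B.image (n - ·)).filter (· < n - a)).card + (B.filter (· < a)).card = B.card := by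
  rw [Finset.filter_image, Finset.card_image_of_injOn
    ((refl_injOn hB).mono (Finset.coe_subset.mpr (Finset.filter_subset _ _)))]
  have : B.filter (fun b => n - b < n - a) = B.filter (fun b => ¬ b < a) := by
    refine Finset.filter_congr fun b hb => ?_
    have := Finset.mem_range.mp (hB hb)
    have : b ≠ a := fun h => ha (h ▸ hb)
    omega
  rw [this, add_comm]
  exact Finset.card_filter_add_card_filter_not _

theorem hat_refl {n : ℕ} {A B : Finset ℕ} (hA : A ⊆ Finset.range (n + 1))
    (hB : B ⊆ Finset.range (n + 1)) (hd : Disjoint A B) (hn : B.card ≤ n) :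
    hat (A.image (n - ·)) (B.image (n - ·)) = (hat A B).image (n - B.card - ·) := by
  simp only [hat_def, Finset.image_image]
  refine Finset.image_congr fun a ha => ?_
  have han : a ≤ n := by have := Finset.mem_range.mp (hA ha); omega
  have h1 := card_filter_refl hB han (Finset.disjoint_left.mp hd ha)
  have h2 := low_add B a
  have h3 := low_add (B.image (n - ·)) (n - a)
  have h4 := hat_subset hA hB hd (Finset.mem_image_of_mem _ ha)
  change low B a ∈ _ at h4
  simp only [Finset.mem_range] at h4
  change low (B.image (n - ·)) (n - a) = n - B.card - low B a
  omega

theorem inversions_refl {n : ℕ} {A B : Finset ℕ} (hA : A ⊆ Finset.range (n + 1))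
    (hB : B ⊆ Finset.range (n + 1)) (hd : Disjoint A B) :
    inversions (A.image (n - ·)) (B.image (n - ·)) + inversions A B = A.card * B.card := by
  unfold inversions
  rw [Finset.sum_image (refl_injOn hA), ← Finset.sum_add_distrib, ← smul_eq_mul,
    ← Finset.sum_const]
  refine Finset.sum_congr rfl fun a ha => ?_
  exact card_filter_refl hB (by have := Finset.mem_range.mp (hA ha); omega)
    (Finset.disjoint_left.mp hd ha)

theorem choose_two_add (a b : ℕ) :
    (a + b) * (a + b - 1) / 2 = a * (a - 1) / 2 + b * (b - 1) / 2 + a * b := by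
  simp only [← Nat.choose_two_right]
  induction b with
  | zero => simp
  | succ b ih =>
    rw [← add_assoc, Nat.choose_succ_succ' (a + b) 1, Nat.choose_succ_succ' b 1, ih]
    simp only [Nat.choose_one_right]
    ring

theorem shuffle_comp_r {c : ℤ} {f : Family X Y} {g : Family Y Z} (hf : IsDihedral f)
    (hg : IsDihedral g) (hfc : HasDegree c f) (n m n' m' : ℕ) (S : Finset ℕ)
    (hS : S ⊆ Finset.range (n + 1)) :
    shuffle c g f n m n' m' S ∘ₗ X.r n m = (-1 : K) ^ (S.card * (S.card - 1) / 2) •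
      (Z.r n' m' ∘ₗ shuffle c g f n m n' m' (S.image (n - ·))) := by
  simp only [shuffle]
  rw [sum_comp', comp_sum', sum_powerset_image (refl_injOn hS), Finset.smul_sum]
  refine Finset.sum_congr rfl fun B hB => ?_
  have hBS := Finset.mem_powerset.mp hB
  have hBn := hBS.trans hS
  have hAn : S \ B ⊆ Finset.range (n + 1) := Finset.sdiff_subset.trans hS
  have hd : Disjoint (S \ B) B := Finset.sdiff_disjoint
  have hcard := Finset.card_sdiff_add_card_eq_card hBS
  rw [← Finset.image_sdiff_of_injOn (refl_injOn hS) hBS, card_image_refl hBn, LinearMap.smul_comp,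
    LinearMap.comp_assoc, hf.comp_r _ _ _ _ _ hBn]
  by_cases hz : f n m (n - B.card) (m + B.card + c).toNat (B.image (n - ·)) = 0
  · simp [hz]
  obtain ⟨-, h2, -⟩ := hfc _ _ _ _ _ hz
  rw [card_image_refl hBn] at h2
  have hh : hat (S \ B) B ⊆ Finset.range (n - B.card + 1) :=
    (hat_subset hAn hBn hd).trans (Finset.range_subset_range.mpr (by omega))
  rw [LinearMap.comp_smul, ← LinearMap.comp_assoc, hg.comp_r _ _ _ _ _ hh, card_hat hd,
    hat_refl hAn hBn hd (by omega)]
  have hinv := inversions_refl hAn hBn hd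
  have hch := choose_two_add (S \ B).card B.card
  rw [hcard] at hch
  simp only [LinearMap.comp_smul, LinearMap.smul_comp, smul_smul, ← pow_add, LinearMap.comp_assoc]
  congr 1
  refine sgn_eq ?_
  generalize (S \ B).card * B.card = p at *
  omega

theorem IsDihedral.shuffle {c : ℤ} {f : Family X Y} {g : Family Y Z} (hf : IsDihedral f)
    (hg : IsDihedral g) (hfc : HasDegree c f) : IsDihedral (shuffle c g f) where
  comp_t_of_notMem := shuffle_comp_t_of_notMem hf hg hfc
  comp_t_of_mem := shuffle_comp_t_of_mem hf hg hfc
  comp_r := shuffle_comp_r hf hg hfc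

end Lemmas

/-- A dihedral module with `∞`-simplicial faces. The entries `∂_{(i_1,…,i_k)}`, `k ≥ 1`, of `face`
are the `∞`-simplicial faces and its entry at `k = 0` is the differential `d` of bidegree `(0,-1)`;
all of them have total degree `-1`. With `d(∂_I) = d ∂_I + ∂_I d`, the relation `face_face` reads
`d² = 0` for the empty tuple and `d(∂_I) = ∑ (-1)^{sign σ + 1} ∂_{I'} ∂_{I''}` (sum over the splittings
of `I` into two nonempty blocks) for the other ones. -/
structure DFModule (K : Type u) [CommRing K] extends DihedralBigraded.{u} K where
  face : Family toDihedralBigraded toDihedralBigraded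
  hasDegree : HasDegree (-1) face
  face_face : shuffle (-1) face face = 0
  isDihedral : IsDihedral face

/-- The family that consists of the identity at the empty tuple. -/
def idFamily (X : DihedralBigraded.{u} K) : Family X X := fun n m n' m' S =>
  if h : n = n' ∧ m = m' ∧ S = ∅ then h.1 ▸ h.2.1 ▸ LinearMap.id else 0

section Lemmas

variable {X Y : DihedralBigraded.{u} K}

theorem idFamily_self (X : DihedralBigraded.{u} K) (n m : ℕ) :
    idFamily X n m n m ∅ = LinearMap.id := by
  simp [idFamily]

theorem idFamily_eq_zero {n m n' m' : ℕ} {S : Finset ℕ} (h : ¬ (n = n' ∧ m = m' ∧ S = ∅)) :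
    idFamily X n m n' m' S = 0 := dif_neg h

theorem idFamily_hasDegree (X : DihedralBigraded.{u} K) : HasDegree 0 (idFamily X) := by
  intro n m n' m' S h
  by_cases h' : n = n' ∧ m = m' ∧ S = ∅
  · obtain ⟨rfl, rfl, rfl⟩ := h'
    simp
  · exact absurd (idFamily_eq_zero h') h

theorem idFamily_isDihedral (X : DihedralBigraded.{u} K) : IsDihedral (idFamily X) where
  comp_t_of_notMem n m n' m' S hS h0 := by
    by_cases h' : n = n' ∧ m = m' ∧ S = ∅
    · obtain ⟨rfl, rfl, rfl⟩ := h'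
      simp [idFamily_self]
    · rw [idFamily_eq_zero h', idFamily_eq_zero (by simpa using h')]
      simp
  comp_t_of_mem n m n' m' S hS h0 := by
    have h1 : S ≠ ∅ := Finset.ne_empty_of_mem h0
    rw [idFamily_eq_zero (by simp [h1]), idFamily_eq_zero (by simp [h1])]
    simp
  comp_r n m n' m' S hS := by
    by_cases h' : n = n' ∧ m = m' ∧ S = ∅
    · obtain ⟨rfl, rfl, rfl⟩ := h'
      simp [idFamily_self]
    · rw [idFamily_eq_zero h', idFamily_eq_zero (by simpa using h')]
      simp

theorem shuffle_id (g : Family X Y) : shuffle 0 g (idFamily X) = g := by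
  funext n m n' m' S
  simp only [shuffle]
  rw [Finset.sum_eq_single ∅]
  · have h1 : ((m : ℤ) + (∅ : Finset ℕ).card + 0).toNat = m := by simp
    rw [h1]
    simp only [Finset.sdiff_empty, inversions, Finset.filter_empty, Finset.card_empty,
      Finset.sum_const_zero, pow_zero, one_smul, hat_empty_right, Nat.sub_zero, idFamily_self]
    rfl
  · intro B _ hB
    rw [idFamily_eq_zero (by simp [hB])]
    simp
  · simp

theorem id_shuffle {c : ℤ} {f : Family X Y} (hf : HasDegree c f) :
    shuffle c (idFamily Y) f = f := by
  funext n m n' m' S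
  simp only [shuffle]
  rw [Finset.sum_eq_single S]
  · simp only [sdiff_self, Finset.bot_eq_empty, hat_empty_left, inversions, Finset.sum_empty,
      pow_zero, one_smul]
    by_cases h : n - S.card = n' ∧ ((m : ℤ) + S.card + c).toNat = m'
    · obtain ⟨rfl, rfl⟩ := h
      rw [idFamily_self, LinearMap.id_comp]
    · rw [idFamily_eq_zero (by tauto), LinearMap.zero_comp, hf.eq_zero]
      rintro ⟨-, h1, h2⟩
      exact h ⟨by omega, by omega⟩
  · intro B hB hBS
    have : hat (S \ B) B ≠ ∅ := by
      simp only [hat, ne_eq, Finset.image_eq_empty, Finset.sdiff_eq_empty_iff_subset]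
      exact fun h => hBS (Finset.Subset.antisymm (Finset.mem_powerset.mp hB) h)
    rw [idFamily_eq_zero (by tauto)]
    simp
  · simp

end Lemmas

namespace DFModule

/-- A morphism of dihedral modules with `∞`-simplicial faces: a family of total degree `0` that
commutes with the dihedral structure and satisfies, with `d(f_I) = d f_I - f_I d`,
`d(f_I) = - ∂_I f_() + f_() ∂_I + ∑ (-1)^{sign σ + 1} (∂_{I'} f_{I''} - f_{I'} ∂_{I''})`. -/
@[ext]
structure Hom (X Y : DFModule.{u} K) where
  family : Family X.toDihedralBigraded Y.toDihedralBigraded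
  hasDegree : HasDegree 0 family
  face_comm : shuffle 0 Y.face family = shuffle (-1) family X.face
  isDihedral : IsDihedral family

/-- The category of dihedral modules with `∞`-simplicial faces, with
`(gf)_I = ∑ (-1)^{sign σ} g_{I'} f_{I''}`. -/
instance : Category (DFModule.{u} K) where
  Hom := Hom
  id X :=
    { family := idFamily _
      hasDegree := idFamily_hasDegree _
      face_comm := by rw [shuffle_id, id_shuffle X.hasDegree]
      isDihedral := idFamily_isDihedral _ }
  comp {X Y Z} f g :=
    { family := shuffle 0 g.family f.family
      hasDegree := f.hasDegree.shuffle g.hasDegree (add_zero 0)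
      face_comm := by
        have h1 := shuffle_assoc (d := 0) (g := g.family) Z.face f.hasDegree
        have h2 := shuffle_assoc (d := -1) (g := Y.face) g.family f.hasDegree
        have h3 := shuffle_assoc (d := 0) (g := f.family) g.family X.hasDegree
        rw [add_zero] at h1 h3
        rw [zero_add] at h2
        rw [← h1, g.face_comm, h2, f.face_comm, h3]
      isDihedral := f.isDihedral.shuffle g.isDihedral f.hasDegree }
  id_comp f := Hom.ext (shuffle_id _)
  comp_id f := Hom.ext (id_shuffle f.hasDegree)
  assoc f g h := by
    have := shuffle_assoc (d := 0) (g := g.family) h.family f.hasDegree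
    rw [add_zero] at this
    exact Hom.ext this.symm

/-- A homotopy between morphisms `f` and `g`: a family of total degree `1` that is compatible with
the dihedral structure and satisfies, with `d(h_I) = d h_I + h_I d`,
`d(h_I) = f_I - g_I - ∂_I h_() - h_() ∂_I + ∑ (-1)^{sign σ + 1} (∂_{I'} h_{I''} + h_{I'} ∂_{I''})`. -/
structure Homotopy {X Y : DFModule.{u} K} (f g : X ⟶ Y) where
  family : Family X.toDihedralBigraded Y.toDihedralBigraded
  hasDegree : HasDegree 1 family
  face_add : shuffle 1 Y.face family + shuffle (-1) family X.face =
    Hom.family f - Hom.family g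
  isDihedral : IsDihedral family

/-- A homotopy equivalence is a morphism that has a homotopy inverse. -/
def IsHomotopyEquivalence {X Y : DFModule.{u} K} (f : X ⟶ Y) : Prop :=
  ∃ g : Y ⟶ X, Nonempty (Homotopy (f ≫ g) (𝟙 X)) ∧ Nonempty (Homotopy (g ≫ f) (𝟙 Y))

end DFModule

/-- `T_n = (-1)^n t_n` -/
def opT (X : DihedralBigraded.{u} K) (n m : ℕ) : Module.End K (X.X n m) := (-1 : K) ^ n • X.t n m

/-- `N_n = 1 + T_n + … + T_n^n` -/
def opN (X : DihedralBigraded.{u} K) (n m : ℕ) : Module.End K (X.X n m) :=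
  ∑ j ∈ Finset.range (n + 1), opT X n m ^ j

/-- `R_n = (-1)^{n(n+1)/2} r_n` -/
def opR (X : DihedralBigraded.{u} K) (n m : ℕ) : Module.End K (X.X n m) :=
  (-1 : K) ^ (n * (n + 1) / 2) • X.r n m

/-- The component `X_{n,m} → Y_{n',m'}` of `∑_k f_q^k`, where `f_q^k` is the sum of
`(-1)^{i_1 + … + i_k} f_{(i_1,…,i_k)}` over `0 ≤ i_1 < … < i_k ≤ n - q`. -/
def altSum {X Y : DihedralBigraded.{u} K} (q : ℕ) (f : Family X Y) (n m n' m' : ℕ) :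
    X.X n m →ₗ[K] Y.X n' m' :=
  ∑ S ∈ (Finset.range (n + 1 - q)).powerset, (-1 : K) ^ (∑ i ∈ S, i) • f n m n' m' S

section Lemmas

variable {X Y Z : DihedralBigraded.{u} K}

theorem opT_pow (X : DihedralBigraded.{u} K) (n m : ℕ) : opT X n m ^ (n + 1) = 1 := by
  rw [opT, smul_pow, X.t_pow, ← pow_mul, Even.neg_one_pow (Nat.even_mul_succ_self n), one_smul]

theorem opR_opR (X : DihedralBigraded.{u} K) (n m : ℕ) : opR X n m * opR X n m = 1 := by
  rw [opR, smul_mul_smul_comm, Module.End.mul_eq_comp, X.r_r, ← pow_add,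
    Even.neg_one_pow (Even.add_self _), one_smul]
  rfl

theorem opT_opR_opT (X : DihedralBigraded.{u} K) (n m : ℕ) :
    opT X n m * (opR X n m * opT X n m) = opR X n m := by
  simp only [opT, opR, smul_mul_smul_comm, Module.End.mul_eq_comp, X.t_r_t, ← pow_add]
  congr 1
  exact sgn_eq (by omega)

theorem opT_opN (X : DihedralBigraded.{u} K) (n m : ℕ) : opT X n m * opN X n m = opN X n m := by
  have h := mul_geom_sum (opT X n m) (n + 1)
  rw [opT_pow, sub_self, sub_mul, one_mul, sub_eq_zero] at h
  exact h

theorem opN_opT (X : DihedralBigraded.{u} K) (n m : ℕ) : opN X n m * opT X n m = opN X n m := by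
  have h := geom_sum_mul (opT X n m) (n + 1)
  rw [opT_pow, sub_self, mul_sub, mul_one, sub_eq_zero] at h
  exact h

theorem opT_pow_opR_opT_pow (X : DihedralBigraded.{u} K) (n m j : ℕ) :
    opT X n m ^ j * (opR X n m * opT X n m ^ j) = opR X n m := by
  induction j with
  | zero => simp
  | succ j ih =>
    calc _ = opT X n m ^ j * (opT X n m * (opR X n m * opT X n m)) * opT X n m ^ j := by
          have h : opT X n m ^ j * opT X n m = opT X n m * opT X n m ^ j :=
            (pow_succ _ _).symm.trans (pow_succ' _ _)
          rw [pow_succ]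
          conv_lhs => rw [mul_assoc, h]
          conv_lhs => rw [← h, h]
          simp only [mul_assoc]
      _ = _ := by rw [opT_opR_opT, mul_assoc, ih]

theorem opN_opR (X : DihedralBigraded.{u} K) (n m : ℕ) :
    opN X n m * opR X n m = opR X n m * opN X n m := by
  have h1 : ∀ j ∈ Finset.range (n + 1), opT X n m ^ j * opR X n m =
      opR X n m * opT X n m ^ (n + 1 - j) := by
    intro j hj
    have hj' : j + (n + 1 - j) = n + 1 := by have := Finset.mem_range.mp hj; omega
    calc _ = opT X n m ^ j * (opR X n m * opT X n m ^ (j + (n + 1 - j))) := by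
          rw [hj', opT_pow, mul_one]
      _ = _ := by rw [pow_add, ← mul_assoc (opR X n m), ← mul_assoc, opT_pow_opR_opT_pow]
  have h2 : ∑ j ∈ Finset.range (n + 1), opT X n m ^ (n + 1 - j) = opN X n m := by
    rw [← opN_opT]
    simp only [opN]
    rw [Finset.sum_mul, ← Finset.sum_range_reflect]
    refine Finset.sum_congr rfl fun j hj => ?_
    rw [← pow_succ]
    congr 1
    have := Finset.mem_range.mp hj
    omega
  calc opN X n m * opR X n m = ∑ j ∈ Finset.range (n + 1), opT X n m ^ j * opR X n m :=
        Finset.sum_mul _ _ _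
    _ = ∑ j ∈ Finset.range (n + 1), opR X n m * opT X n m ^ (n + 1 - j) := Finset.sum_congr rfl h1
    _ = _ := by rw [← Finset.mul_sum, h2]

/-- a family with the sign `(-1)^{i_1 + … + i_k}` -/
def signed (f : Family X Y) : Family X Y := fun n m n' m' S =>
  (-1 : K) ^ (∑ i ∈ S, i) • f n m n' m' S

theorem altSum_eq (q : ℕ) (f : Family X Y) (n m n' m' : ℕ) :
    altSum q f n m n' m' =
      ∑ S ∈ (Finset.range (n + 1 - q)).powerset, signed f n m n' m' S := rfl

theorem sum_rot_of_notMem {n : ℕ} {S : Finset ℕ} (hS : S ⊆ Finset.range (n + 1)) (h0 : 0 ∉ S) :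
    ∑ i ∈ S.image (rot n), i + S.card = ∑ i ∈ S, i := by
  rw [Finset.sum_image (rot_injOn' hS), Finset.card_eq_sum_ones, ← Finset.sum_add_distrib]
  refine Finset.sum_congr rfl fun i hi => ?_
  have : i ≠ 0 := fun h => h0 (h ▸ hi)
  simp only [rot, this, if_false]
  omega

theorem sum_rot_of_mem {n : ℕ} {S : Finset ℕ} (hS : S ⊆ Finset.range (n + 1)) (h0 : 0 ∈ S) :
    ∑ i ∈ S.image (rot n), i + S.card = ∑ i ∈ S, i + n + 1 := by
  rw [Finset.sum_image (rot_injOn' hS), Finset.card_eq_sum_ones, ← Finset.sum_add_distrib,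
    add_assoc]
  have : n + 1 = ∑ i ∈ S, if i = 0 then n + 1 else 0 := by
    rw [Finset.sum_ite_eq' S 0 (fun _ => n + 1), if_pos h0]
  rw [this, ← Finset.sum_add_distrib]
  refine Finset.sum_congr rfl fun i hi => ?_
  simp only [rot]
  split_ifs <;> omega

theorem sum_refl {n : ℕ} {S : Finset ℕ} (hS : S ⊆ Finset.range (n + 1)) :
    ∑ i ∈ S.image (n - ·), i + ∑ i ∈ S, i = n * S.card := by
  rw [Finset.sum_image (refl_injOn hS), ← Finset.sum_add_distrib, mul_comm, ← smul_eq_mul,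
    ← Finset.sum_const]
  refine Finset.sum_congr rfl fun i hi => ?_
  have := Finset.mem_range.mp (hS hi)
  omega

theorem signed_comp_T_of_notMem {c : ℤ} {f : Family X Y} (hf : IsDihedral f) (hfc : HasDegree c f)
    (n m n' m' : ℕ) {S : Finset ℕ} (hS : S ⊆ Finset.range (n + 1)) (h0 : 0 ∉ S) :
    signed f n m n' m' S ∘ₗ opT X n m = opT Y n' m' ∘ₗ signed f n m n' m' (S.image (rot n)) := by
  simp only [signed, opT, LinearMap.smul_comp, LinearMap.comp_smul,
    hf.comp_t_of_notMem _ _ _ _ _ hS h0, smul_smul, ← pow_add]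
  by_cases hz : f n m n' m' (S.image (rot n)) = 0
  · simp [hz]
  obtain ⟨-, h2, -⟩ := hfc _ _ _ _ _ hz
  rw [card_image_rot hS] at h2
  have := sum_rot_of_notMem hS h0
  congr 1
  exact sgn_eq (by omega)

theorem signed_comp_T_of_mem {f : Family X Y} (hf : IsDihedral f)
    (n m n' m' : ℕ) {S : Finset ℕ} (hS : S ⊆ Finset.range (n + 1)) (h0 : 0 ∈ S) :
    signed f n m n' m' S ∘ₗ opT X n m = signed f n m n' m' (S.image (rot n)) := by
  simp only [signed, opT, LinearMap.smul_comp, LinearMap.comp_smul,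
    hf.comp_t_of_mem _ _ _ _ _ hS h0, smul_smul, ← pow_add]
  have := sum_rot_of_mem hS h0
  have := Finset.card_pos.mpr ⟨0, h0⟩
  congr 1
  exact sgn_eq (by omega)

theorem parity_aux {n n' k s s' : ℕ} (h2 : n' + k = n) (h3 : s' + s = n * k) :
    (n * (n + 1) / 2 + (s + k * (k - 1) / 2)) % 2 = (s' + n' * (n' + 1) / 2) % 2 := by
  subst h2
  have e1 := Nat.div_mul_cancel (Nat.even_mul_succ_self n').two_dvd
  have e2 := Nat.div_mul_cancel (Nat.even_mul_pred_self k).two_dvd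
  have e3 := Nat.div_mul_cancel (Nat.even_mul_succ_self (n' + k)).two_dvd
  have e4 : k * (k - 1) + k = k * k := by
    rcases k with _ | k
    · simp
    · simp only [Nat.add_sub_cancel]; ring
  have e5 : (n' + k) * (n' + k + 1) = n' * (n' + 1) + 2 * (n' * k) + k * k + k := by ring
  have e6 : (n' + k) * k = n' * k + k * k := by ring
  omega

theorem signed_comp_R {c : ℤ} {f : Family X Y} (hf : IsDihedral f) (hfc : HasDegree c f)
    (n m n' m' : ℕ) {S : Finset ℕ} (hS : S ⊆ Finset.range (n + 1)) :
    signed f n m n' m' S ∘ₗ opR X n m = opR Y n' m' ∘ₗ signed f n m n' m' (S.image (n - ·)) := by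
  simp only [signed, opR, LinearMap.smul_comp, LinearMap.comp_smul,
    hf.comp_r _ _ _ _ _ hS, smul_smul, ← pow_add]
  by_cases hz : f n m n' m' (S.image (n - ·)) = 0
  · simp [hz]
  obtain ⟨-, h2, -⟩ := hfc _ _ _ _ _ hz
  rw [card_image_refl hS] at h2
  have h3 := sum_refl hS
  congr 1
  refine sgn_eq ?_
  exact parity_aux h2 h3

theorem image_rot_range (n : ℕ) :
    (Finset.range (n + 1)).image (rot n) = Finset.range (n + 1) :=
  Finset.eq_of_subset_of_card_le (rot_image_subset le_rfl) (by rw [card_image_rot le_rfl])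

theorem image_rot_erase (n : ℕ) :
    ((Finset.range (n + 1)).erase 0).image (rot n) = Finset.range n := by
  ext x
  simp only [Finset.mem_image, Finset.mem_erase, Finset.mem_range, rot]
  constructor
  · rintro ⟨a, ⟨h1, h2⟩, rfl⟩
    rw [if_neg h1]; omega
  · intro h
    exact ⟨x + 1, ⟨by omega, by omega⟩, by simp⟩

theorem altSum_zero_comp {c : ℤ} {f : Family X Y} (hf : IsDihedral f) (hfc : HasDegree c f)
    (n m n' m' : ℕ) :
    altSum 0 f n m n' m' ∘ₗ (1 - opT X n m) = (1 - opT Y n' m') ∘ₗ altSum 1 f n m n' m' := by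
  set E := (Finset.range (n + 1)).erase 0 with hE
  have hins : insert 0 E = Finset.range (n + 1) := Finset.insert_erase (by simp)
  have h0E : 0 ∉ E := Finset.notMem_erase _ _
  have hEn : E ⊆ Finset.range (n + 1) := Finset.erase_subset _ _
  have h1 : altSum 0 f n m n' m' =
      ∑ S ∈ E.powerset, signed f n m n' m' (S.image (rot n)) +
      ∑ S ∈ E.powerset, signed f n m n' m' ((insert 0 S).image (rot n)) := by
    rw [← Finset.sum_powerset_insert h0E (fun S => signed f n m n' m' (S.image (rot n))), hins,
      ← sum_powerset_image (rot_injOn' le_rfl), image_rot_range]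
    rfl
  have h2 : altSum 1 f n m n' m' = ∑ S ∈ E.powerset, signed f n m n' m' (S.image (rot n)) := by
    rw [← sum_powerset_image (rot_injOn' hEn), image_rot_erase]
    rfl
  have h3 : altSum 0 f n m n' m' ∘ₗ opT X n m = opT Y n' m' ∘ₗ altSum 1 f n m n' m' +
      ∑ S ∈ E.powerset, signed f n m n' m' ((insert 0 S).image (rot n)) := by
    rw [altSum_eq, Nat.sub_zero, ← hins, Finset.sum_powerset_insert h0E, LinearMap.add_comp, h2,
      sum_comp', sum_comp', comp_sum']
    congr 1
    · refine Finset.sum_congr rfl fun S hS => ?_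
      have hS' := Finset.mem_powerset.mp hS
      exact signed_comp_T_of_notMem hf hfc n m n' m' (hS'.trans hEn) (fun h => h0E (hS' h))
    · refine Finset.sum_congr rfl fun S hS => ?_
      have hS' := Finset.mem_powerset.mp hS
      refine signed_comp_T_of_mem hf n m n' m' ?_ (Finset.mem_insert_self _ _)
      rw [← hins]
      exact Finset.insert_subset_insert _ hS'
  rw [LinearMap.comp_sub, h3, LinearMap.sub_comp]
  change altSum 0 f n m n' m' - _ = altSum 1 f n m n' m' - _
  rw [h1, h2]
  abel

theorem sum_pow_card_filter {R : Type*} [Semiring R] (T : R) (C : Finset ℕ) :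
    ∑ i ∈ C, T ^ (C.filter (i < ·)).card = ∑ e ∈ Finset.range C.card, T ^ e := by
  induction C using Finset.induction_on_min with
  | empty => simp
  | insert a C ha ih =>
    have haC : a ∉ C := fun h => lt_irrefl _ (ha a h)
    rw [Finset.sum_insert haC, Finset.card_insert_of_notMem haC, Finset.sum_range_succ, ← ih,
      add_comm]
    congr 1
    · refine Finset.sum_congr rfl fun i hi => ?_
      rw [Finset.filter_insert, if_neg (by have := ha i hi; omega)]
    · rw [Finset.filter_insert, if_neg (lt_irrefl _), Finset.filter_true_of_mem ha]

/-- the `j`-th power of the cyclic shift -/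
def rotPow (n j i : ℕ) : ℕ := if i < j then i + (n + 1 - j) else i - j

theorem rotPow_injOn {n j : ℕ} (hj : j ≤ n + 1) {S : Finset ℕ} (hS : S ⊆ Finset.range (n + 1)) :
    Set.InjOn (rotPow n j) S := by
  intro a ha b hb h
  have h1 := Finset.mem_range.mp (hS ha)
  have h2 := Finset.mem_range.mp (hS hb)
  simp only [rotPow] at h
  split_ifs at h <;> omega

theorem rotPow_succ {n j i : ℕ} (hj : j ≤ n) (hi : i ≤ n) :
    rot n (rotPow n j i) = rotPow n (j + 1) i := by
  simp only [rot, rotPow]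
  split_ifs <;> omega

theorem signed_comp_T_pow {c : ℤ} {f : Family X Y} (hf : IsDihedral f) (hfc : HasDegree c f)
    (n m n' m' : ℕ) {S : Finset ℕ} (hS : S ⊆ Finset.range (n + 1)) (j : ℕ) (hj : j ≤ n + 1) :
    signed f n m n' m' S ∘ₗ (opT X n m ^ j) = (opT Y n' m' ^ (Finset.range j \ S).card) ∘ₗ
      signed f n m n' m' (S.image (rotPow n j)) := by
  induction j with
  | zero =>
    have : S.image (rotPow n 0) = S := by
      have h : rotPow n 0 = id := by funext i; simp [rotPow]
      rw [h, Finset.image_id]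
    rw [this, pow_zero, Finset.range_zero, Finset.empty_sdiff, Finset.card_empty, pow_zero]
    rfl
  | succ j ih =>
    have hj' : j ≤ n := by omega
    have himg : (S.image (rotPow n j)).image (rot n) = S.image (rotPow n (j + 1)) := by
      rw [Finset.image_image]
      refine Finset.image_congr fun i hi => ?_
      exact rotPow_succ hj' (by have := Finset.mem_range.mp (hS hi); omega)
    have hsub : S.image (rotPow n j) ⊆ Finset.range (n + 1) := by
      intro x hx
      obtain ⟨i, hi, rfl⟩ := Finset.mem_image.mp hx
      have := Finset.mem_range.mp (hS hi)
      simp only [rotPow, Finset.mem_range]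
      split_ifs <;> omega
    have hmem : 0 ∈ S.image (rotPow n j) ↔ j ∈ S := by
      simp only [Finset.mem_image, rotPow]
      constructor
      · rintro ⟨i, hi, h⟩
        split_ifs at h with h1
        · omega
        · have : i = j := by omega
          exact this ▸ hi
      · intro h
        exact ⟨j, h, by simp⟩
    rw [pow_succ, Module.End.mul_eq_comp, ← LinearMap.comp_assoc, ih (by omega),
      LinearMap.comp_assoc]
    by_cases h : j ∈ S
    · rw [signed_comp_T_of_mem hf n m n' m' hsub (hmem.mpr h), himg]
      congr 3
      ext x
      simp only [Finset.mem_sdiff, Finset.mem_range]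
      constructor
      · rintro ⟨h1, h2⟩; exact ⟨by omega, h2⟩
      · rintro ⟨h1, h2⟩
        have : x ≠ j := fun h' => h2 (h' ▸ h)
        exact ⟨by omega, h2⟩
    · rw [signed_comp_T_of_notMem hf hfc n m n' m' hsub (by rwa [hmem]), himg]
      have : Finset.range (j + 1) \ S = insert j (Finset.range j \ S) := by
        rw [Finset.range_add_one, Finset.insert_sdiff_of_notMem _ h]
      rw [this, Finset.card_insert_of_notMem (by simp), pow_succ, Module.End.mul_eq_comp,
        LinearMap.comp_assoc]

theorem image_rotPow_range {n j : ℕ} (hj : j ≤ n) :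
    (Finset.range n).image (rotPow n j) = (Finset.range (n + 1)).erase (n - j) := by
  ext x
  simp only [Finset.mem_image, Finset.mem_erase, Finset.mem_range, rotPow]
  constructor
  · rintro ⟨a, h1, rfl⟩
    split_ifs <;> omega
  · rintro ⟨h1, h2⟩
    by_cases h : x < n - j
    · exact ⟨x + j, by omega, by rw [if_neg (by omega)]; omega⟩
    · exact ⟨x - (n + 1 - j), by omega, by rw [if_pos (by omega)]; omega⟩

theorem card_range_sdiff {n j : ℕ} (hj : j ≤ n) {S : Finset ℕ} (hS : S ⊆ Finset.range n) :
    (Finset.range j \ S).card =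
      ((Finset.range (n + 1) \ S.image (rotPow n j)).filter (n - j < ·)).card := by
  have hSn : S ⊆ Finset.range (n + 1) :=
    hS.trans (Finset.range_subset_range.mpr (by omega))
  have : (Finset.range (n + 1) \ S.image (rotPow n j)).filter (n - j < ·) =
      (Finset.range j \ S).image (rotPow n j) := by
    ext x
    simp only [Finset.mem_image, Finset.mem_filter, Finset.mem_sdiff, Finset.mem_range]
    constructor
    · rintro ⟨⟨h1, h2⟩, h3⟩
      refine ⟨x - (n + 1 - j), ⟨by omega, fun h => h2 ⟨_, h, ?_⟩⟩, ?_⟩ <;>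
      · simp only [rotPow]
        rw [if_pos (by omega)]; omega
    · rintro ⟨a, ⟨h1, h2⟩, rfl⟩
      have h3 : rotPow n j a = a + (n + 1 - j) := by simp only [rotPow]; rw [if_pos h1]
      refine ⟨⟨by omega, ?_⟩, by omega⟩
      rintro ⟨b, hb, hab⟩
      have hbn := Finset.mem_range.mp (hSn hb)
      have : b = a := rotPow_injOn (by omega : j ≤ n + 1) (S := Finset.range (n + 1)) le_rfl
        (by simpa using hbn) (by simp; omega) hab
      exact h2 (this ▸ hb)
  rw [this, Finset.card_image_of_injOn]
  exact rotPow_injOn (by omega) (Finset.sdiff_subset.trans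
    (Finset.range_subset_range.mpr (by omega)))

theorem altSum_one_comp {c : ℤ} {f : Family X Y} (hf : IsDihedral f) (hfc : HasDegree c f)
    (n m n' m' : ℕ) :
    altSum 1 f n m n' m' ∘ₗ opN X n m = opN Y n' m' ∘ₗ altSum 0 f n m n' m' := by
  set φ : ℕ → Finset ℕ → (X.X n m →ₗ[K] Y.X n' m') := fun i U =>
    (opT Y n' m' ^ ((Finset.range (n + 1) \ U).filter (i < ·)).card) ∘ₗ signed f n m n' m' U with hφ
  have h1 : altSum 1 f n m n' m' ∘ₗ opN X n m =
      ∑ j ∈ Finset.range (n + 1), ∑ U ∈ ((Finset.range (n + 1)).erase (n - j)).powerset,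
        φ (n - j) U := by
    rw [opN, comp_sum']
    refine Finset.sum_congr rfl fun j hj => ?_
    have hj' : j ≤ n := by have := Finset.mem_range.mp hj; omega
    rw [← image_rotPow_range hj', sum_powerset_image (rotPow_injOn (by omega : j ≤ n + 1)
      (Finset.range_subset_range.mpr (by omega))), altSum_eq, sum_comp']
    refine Finset.sum_congr rfl fun S hS => ?_
    have hS' := Finset.mem_powerset.mp hS
    rw [signed_comp_T_pow hf hfc n m n' m'
      (hS'.trans (Finset.range_subset_range.mpr (by omega))) j (by omega),
      card_range_sdiff hj' hS']
  have h2 : ∑ j ∈ Finset.range (n + 1), ∑ U ∈ ((Finset.range (n + 1)).erase (n - j)).powerset,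
        φ (n - j) U = ∑ i ∈ Finset.range (n + 1),
          ∑ U ∈ ((Finset.range (n + 1)).erase i).powerset, φ i U := by
    rw [← Finset.sum_range_reflect]
    refine Finset.sum_congr rfl fun j hj => ?_
    have : n - (n + 1 - 1 - j) = j := by have := Finset.mem_range.mp hj; omega
    rw [this]
  have h3 : ∑ i ∈ Finset.range (n + 1), ∑ U ∈ ((Finset.range (n + 1)).erase i).powerset, φ i U =
      ∑ U ∈ (Finset.range (n + 1)).powerset, ∑ i ∈ Finset.range (n + 1) \ U, φ i U := by
    refine Finset.sum_comm' fun i U => ?_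
    simp only [Finset.mem_powerset, Finset.mem_sdiff, Finset.subset_erase]
    tauto
  rw [h1, h2, h3, altSum_eq, comp_sum']
  refine Finset.sum_congr rfl fun U hU => ?_
  have hU' : U ⊆ Finset.range (n + 1) := Finset.mem_powerset.mp hU
  rw [hφ]
  simp only
  rw [← sum_comp', sum_pow_card_filter]
  by_cases hz : f n m n' m' U = 0
  · simp [signed, hz]
  obtain ⟨-, h2, -⟩ := hfc _ _ _ _ _ hz
  rw [Finset.card_sdiff_of_subset hU', Finset.card_range, opN]
  congr 3
  omega

theorem altSum_zero_comp_R {c : ℤ} {f : Family X Y} (hf : IsDihedral f) (hfc : HasDegree c f)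
    (n m n' m' : ℕ) :
    altSum 0 f n m n' m' ∘ₗ opR X n m = opR Y n' m' ∘ₗ altSum 0 f n m n' m' := by
  have himg : (Finset.range (n + 1)).image (n - ·) = Finset.range (n + 1) := by
    refine Finset.eq_of_subset_of_card_le ?_ (by rw [card_image_refl le_rfl])
    intro x hx
    obtain ⟨a, ha, rfl⟩ := Finset.mem_image.mp hx
    simp only [Finset.mem_range]
    omega
  have h1 : altSum 0 f n m n' m' =
      ∑ S ∈ (Finset.range (n + 1)).powerset, signed f n m n' m' (S.image (n - ·)) := by
    rw [← sum_powerset_image (refl_injOn le_rfl), himg]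
    rfl
  conv_rhs => rw [h1]
  rw [altSum_eq, sum_comp', comp_sum']
  exact Finset.sum_congr rfl fun S hS =>
    signed_comp_R hf hfc n m n' m' (Finset.mem_powerset.mp hS)

theorem altSum_one_comp_R_T {c : ℤ} {f : Family X Y} (hf : IsDihedral f) (hfc : HasDegree c f)
    (n m n' m' : ℕ) :
    altSum 1 f n m n' m' ∘ₗ (opR X n m * opT X n m) =
      (opR Y n' m' * opT Y n' m') ∘ₗ altSum 1 f n m n' m' := by
  have hsub : Finset.range n ⊆ Finset.range (n + 1) := Finset.range_subset_range.mpr (by omega)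
  have himg0 : (Finset.range n).image (n - ·) = (Finset.range (n + 1)).erase 0 := by
    ext x
    simp only [Finset.mem_image, Finset.mem_erase, Finset.mem_range]
    constructor
    · rintro ⟨a, h1, rfl⟩
      omega
    · rintro ⟨h1, h2⟩
      exact ⟨n - x, by omega, by omega⟩
  have himg : ((Finset.range n).image (n - ·)).image (rot n) = Finset.range n := by
    rw [himg0, image_rot_erase]
  have h1 : altSum 1 f n m n' m' = ∑ S ∈ (Finset.range n).powerset,
      signed f n m n' m' ((S.image (n - ·)).image (rot n)) := by
    rw [← sum_powerset_image (f := (n - ·)) (refl_injOn hsub)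
      (fun S => signed f n m n' m' (S.image (rot n))),
      ← sum_powerset_image (f := rot n) (rot_injOn' (by rw [himg0]; exact Finset.erase_subset _ _)),
      himg]
    rfl
  conv_rhs => rw [h1]
  rw [altSum_eq, sum_comp', comp_sum']
  refine Finset.sum_congr rfl fun S hS => ?_
  have hS' := Finset.mem_powerset.mp hS
  have hi : S.image (n - ·) ⊆ (Finset.range (n + 1)).erase 0 :=
    himg0 ▸ Finset.image_subset_image hS'
  rw [Module.End.mul_eq_comp, ← LinearMap.comp_assoc, signed_comp_R hf hfc n m n' m' (hS'.trans hsub),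
    LinearMap.comp_assoc, signed_comp_T_of_notMem hf hfc n m n' m'
      (hi.trans (Finset.erase_subset _ _)) (fun h => absurd (hi h) (by simp)),
    Module.End.mul_eq_comp, LinearMap.comp_assoc]

end Lemmas

/-- The module of total degree `N`: the (finite) direct sum of the `X_{i,N-i}`, `0 ≤ i ≤ N`. -/
abbrev Bar (X : DihedralBigraded.{u} K) (N : ℕ) : Type u := ∀ i : Fin (N + 1), X.X i (N - i)

/-- The map `∑_k f_q^k` between the modules of total degrees `N` and `N'`; it vanishes unless
`N' - N` is the degree of the family. -/
def bar {X Y : DihedralBigraded.{u} K} (q : ℕ) (f : Family X Y) (N N' : ℕ) :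
    Bar X N →ₗ[K] Bar Y N' :=
  LinearMap.pi fun j => ∑ i : Fin (N + 1), altSum q f i (N - i) j (N' - j) ∘ₗ
    (LinearMap.proj i : Bar X N →ₗ[K] X.X i (N - i))

/-- The endomorphism of the module of total degree `N` that is given by endomorphisms of the
`X_{n,m}`. -/
def barDiag {X : DihedralBigraded.{u} K} (φ : ∀ n m, Module.End K (X.X n m)) (N : ℕ) :
    Module.End K (Bar X N) :=
  LinearMap.pi fun i => φ i (N - i) ∘ₗ (LinearMap.proj i : Bar X N →ₗ[K] X.X i (N - i))

def barT (X : DihedralBigraded.{u} K) (N : ℕ) : Module.End K (Bar X N) := barDiag (opT X) N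
def barN (X : DihedralBigraded.{u} K) (N : ℕ) : Module.End K (Bar X N) := barDiag (opN X) N
def barR (X : DihedralBigraded.{u} K) (N : ℕ) : Module.End K (Bar X N) := barDiag (opR X) N

section Lemmas

variable {X Y Z : DihedralBigraded.{u} K}

theorem altSum_eq_zero {c : ℤ} {f : Family X Y} (hf : HasDegree c f) (q : ℕ) {n m n' m' : ℕ}
    (h : (n' : ℤ) + m' ≠ n + m + c) : altSum q f n m n' m' = 0 := by
  refine Finset.sum_eq_zero fun S _ => ?_
  rw [hf.eq_zero, smul_zero]
  rintro ⟨-, h1, h2⟩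
  omega

theorem bar_eq_zero {c : ℤ} {f : Family X Y} (hf : HasDegree c f) (q : ℕ) {N N' : ℕ}
    (h : (N' : ℤ) ≠ N + c) : bar q f N N' = 0 := by
  refine LinearMap.ext fun x => funext fun j => ?_
  simp only [bar, LinearMap.pi_apply, LinearMap.sum_apply, LinearMap.zero_apply, Pi.zero_apply]
  refine Finset.sum_eq_zero fun i _ => ?_
  rw [altSum_eq_zero hf]
  · rfl
  · have := i.2
    have := j.2
    omega

theorem altSum_shuffle {c : ℤ} {f : Family X Y} {g : Family Y Z} {q : ℕ} (hq : q ≤ 1)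
    (hf : HasDegree c f) (n m n' m' : ℕ) :
    altSum q (shuffle c g f) n m n' m' = ∑ B ∈ (Finset.range (n + 1 - q)).powerset,
      altSum q g (n - B.card) (m + B.card + c).toNat n' m' ∘ₗ
        signed f n m (n - B.card) (m + B.card + c).toNat B := by
  have h1 : altSum q (shuffle c g f) n m n' m' =
      ∑ S ∈ (Finset.range (n + 1 - q)).powerset, ∑ B ∈ S.powerset,
        signed g (n - B.card) (m + B.card + c).toNat n' m' (hat (S \ B) B) ∘ₗ
          signed f n m (n - B.card) (m + B.card + c).toNat B := by
    refine Finset.sum_congr rfl fun S _ => ?_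
    simp only [shuffle]
    rw [Finset.smul_sum]
    refine Finset.sum_congr rfl fun B hB => ?_
    have hBS := Finset.mem_powerset.mp hB
    have e1 := sum_hat (A := S \ B) (B := B) Finset.sdiff_disjoint
    have e2 := Finset.sum_sdiff (f := fun i => i) hBS
    simp only [signed, LinearMap.smul_comp, LinearMap.comp_smul, smul_smul, ← pow_add]
    congr 1
    exact sgn_eq (by omega)
  rw [h1]
  have h2 := sum_powerset_powerset (Finset.range (n + 1 - q)) (fun B D =>
        signed g (n - B.card) (m + B.card + c).toNat n' m' (hat D B) ∘ₗ
          signed f n m (n - B.card) (m + B.card + c).toNat B)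
  rw [h2]
  refine Finset.sum_congr rfl fun B hB => ?_
  have hBS := Finset.mem_powerset.mp hB
  by_cases hz : f n m (n - B.card) (m + B.card + c).toNat B = 0
  · simp [signed, hz]
  obtain ⟨-, h3, -⟩ := hf _ _ _ _ _ hz
  have h4 : n - B.card + 1 - q = n + 1 - q - B.card := by omega
  rw [altSum_eq, sum_comp', h4, ← hat_range hBS, hat_def,
    sum_powerset_image (low_injOn Finset.sdiff_disjoint)]
  rfl

theorem bar_shuffle {c : ℤ} {f : Family X Y} {g : Family Y Z} {q : ℕ} (hq : q ≤ 1)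
    (hf : HasDegree c f) {N N' : ℕ} (hN : (N' : ℤ) = N + c) (N'' : ℕ) :
    bar q (shuffle c g f) N N'' = bar q g N' N'' ∘ₗ bar q f N N' := by
  refine LinearMap.ext fun x => funext fun j => ?_
  simp only [bar, LinearMap.pi_apply, LinearMap.sum_apply, LinearMap.comp_apply, LinearMap.proj_apply,
    map_sum]
  rw [Finset.sum_comm]
  refine Finset.sum_congr rfl fun i _ => ?_
  rw [altSum_shuffle hq hf, LinearMap.sum_apply]
  simp only [altSum_eq q f, LinearMap.sum_apply, map_sum]
  rw [Finset.sum_comm]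
  refine Finset.sum_congr rfl fun B _ => ?_
  simp only [LinearMap.comp_apply]
  have hi := i.2
  by_cases hz : f i (N - i) (i - B.card) ((N - i : ℕ) + B.card + c : ℤ).toNat B = 0
  · rw [signed, hz, smul_zero, LinearMap.zero_apply, map_zero, Finset.sum_eq_zero]
    intro k _
    by_cases hz' : f i (N - i) k (N' - k) B = 0
    · rw [signed, hz', smul_zero, LinearMap.zero_apply, map_zero]
    · obtain ⟨-, h1, h2⟩ := hf _ _ _ _ _ hz'
      have e1 : (i : ℕ) - B.card = k := by omega
      have e2 : ((N - i : ℕ) + B.card + c : ℤ).toNat = N' - k := by omega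
      rw [e1, e2] at hz
      exact absurd hz hz'
  · obtain ⟨-, h1, h2⟩ := hf _ _ _ _ _ hz
    have hlt : (i : ℕ) - B.card < N' + 1 := by omega
    rw [Finset.sum_eq_single (⟨(i : ℕ) - B.card, hlt⟩ : Fin (N' + 1))]
    · have e2 : ((N - i : ℕ) + B.card + c : ℤ).toNat = N' - (i - B.card) := by omega
      rw [e2]
    · intro k _ hk
      rw [signed, hf.eq_zero, smul_zero, LinearMap.zero_apply, map_zero]
      rintro ⟨-, h3, h4⟩
      exact hk (Fin.ext (by simp; omega))
    · simp

theorem altSum_idFamily (q n m n' m' : ℕ) :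
    altSum q (idFamily X) n m n' m' = idFamily X n m n' m' ∅ := by
  rw [altSum, Finset.sum_eq_single ∅]
  · simp
  · intro S _ hS
    rw [idFamily_eq_zero (by tauto), smul_zero]
  · simp

theorem bar_idFamily (q N : ℕ) : bar q (idFamily X) N N = LinearMap.id := by
  refine LinearMap.ext fun x => funext fun j => ?_
  simp only [bar, LinearMap.pi_apply, LinearMap.sum_apply, LinearMap.comp_apply,
    LinearMap.proj_apply, altSum_idFamily]
  rw [Finset.sum_eq_single j]
  · rw [idFamily_self]; rfl
  · intro i _ hij
    rw [idFamily_eq_zero, LinearMap.zero_apply]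
    rintro ⟨h, -⟩
    exact hij (Fin.ext h)
  · simp

theorem bar_comp_barDiag {q q' : ℕ} {f : Family X Y} {φ : ∀ n m, Module.End K (X.X n m)}
    {ψ : ∀ n m, Module.End K (Y.X n m)}
    (h : ∀ n m n' m', altSum q f n m n' m' ∘ₗ φ n m = ψ n' m' ∘ₗ altSum q' f n m n' m') (N N' : ℕ) :
    bar q f N N' ∘ₗ barDiag φ N = barDiag ψ N' ∘ₗ bar q' f N N' := by
  refine LinearMap.ext fun x => funext fun j => ?_
  simp only [bar, barDiag, LinearMap.pi_apply, LinearMap.sum_apply, LinearMap.comp_apply,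
    LinearMap.proj_apply, map_sum]
  exact Finset.sum_congr rfl fun i _ => LinearMap.congr_fun (h _ _ _ _) _

theorem barDiag_mul (φ ψ : ∀ n m, Module.End K (X.X n m)) (N : ℕ) :
    barDiag φ N * barDiag ψ N = barDiag (fun n m => φ n m * ψ n m) N := rfl

theorem one_sub_barT (N : ℕ) : 1 - barT X N = barDiag (fun n m => 1 - opT X n m) N := rfl

theorem barDiag_one (N : ℕ) : barDiag (fun n m => (1 : Module.End K (X.X n m))) N = 1 := rfl

variable {c : ℤ} {f : Family X Y}

theorem bar_zero_comp (hf : IsDihedral f) (hfc : HasDegree c f) (N N' : ℕ) :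
    bar 0 f N N' ∘ₗ (1 - barT X N) = (1 - barT Y N') ∘ₗ bar 1 f N N' :=
  bar_comp_barDiag (altSum_zero_comp hf hfc) N N'

theorem bar_one_comp (hf : IsDihedral f) (hfc : HasDegree c f) (N N' : ℕ) :
    bar 1 f N N' ∘ₗ barN X N = barN Y N' ∘ₗ bar 0 f N N' :=
  bar_comp_barDiag (altSum_one_comp hf hfc) N N'

theorem bar_zero_comp_R (hf : IsDihedral f) (hfc : HasDegree c f) (N N' : ℕ) :
    bar 0 f N N' ∘ₗ barR X N = barR Y N' ∘ₗ bar 0 f N N' :=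
  bar_comp_barDiag (altSum_zero_comp_R hf hfc) N N'

theorem bar_one_comp_R_T (hf : IsDihedral f) (hfc : HasDegree c f) (N N' : ℕ) :
    bar 1 f N N' ∘ₗ (barR X N * barT X N) = (barR Y N' * barT Y N') ∘ₗ bar 1 f N N' :=
  bar_comp_barDiag (altSum_one_comp_R_T hf hfc) N N'

theorem barR_barR (X : DihedralBigraded.{u} K) (N : ℕ) : barR X N * barR X N = 1 := by
  simp only [barR, barDiag_mul, opR_opR]
  rfl

theorem barT_barR_barT (X : DihedralBigraded.{u} K) (N : ℕ) :
    barT X N * (barR X N * barT X N) = barR X N := by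
  simp only [barR, barT, barDiag_mul, opT_opR_opT]

theorem barT_barN (X : DihedralBigraded.{u} K) (N : ℕ) : barT X N * barN X N = barN X N := by
  simp only [barN, barT, barDiag_mul, opT_opN]

theorem barN_barT (X : DihedralBigraded.{u} K) (N : ℕ) : barN X N * barT X N = barN X N := by
  simp only [barN, barT, barDiag_mul, opN_opT]

theorem barN_barR (X : DihedralBigraded.{u} K) (N : ℕ) :
    barN X N * barR X N = barR X N * barN X N := by
  simp only [barN, barR, barDiag_mul, opN_opR]

end Lemmas

/-- The automorphism `ϑ` of order two, on the column with index `m` and in total degree `N`. -/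
def theta (X : DihedralBigraded.{u} K) (m N : ℕ) : Module.End K (Bar X N) :=
  if Even m then (-1 : K) ^ (m / 2) • barR X N
  else (-1 : K) ^ (m / 2 + 1) • (barR X N * barT X N)

/-- The horizontal differential of the cyclic bicomplex that starts in the column `m`. -/
def delta₂ (X : DihedralBigraded.{u} K) (m N : ℕ) : Module.End K (Bar X N) :=
  if Even m then barN X N else 1 - barT X N

section Lemmas

variable {X Y : DihedralBigraded.{u} K}

theorem theta_theta (X : DihedralBigraded.{u} K) (m N : ℕ) : theta X m N * theta X m N = 1 := by
  unfold theta
  split_ifs with h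
  · rw [smul_mul_smul_comm, barR_barR, ← pow_add, Even.neg_one_pow (Even.add_self _), one_smul]
  · rw [smul_mul_smul_comm, mul_assoc, barT_barR_barT, barR_barR, ← pow_add,
      Even.neg_one_pow (Even.add_self _), one_smul]

theorem delta₂_delta₂ (X : DihedralBigraded.{u} K) (m N : ℕ) :
    delta₂ X m N * delta₂ X (m + 1) N = 0 := by
  unfold delta₂
  by_cases h : Even m
  · rw [if_pos h, if_neg (by simpa [Nat.even_add_one] using h), mul_sub, mul_one, barN_barT, sub_self]
  · rw [if_neg h, if_pos (by simpa [Nat.even_add_one] using h), sub_mul, one_mul, barT_barN, sub_self]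

theorem delta₂_theta (X : DihedralBigraded.{u} K) (m N : ℕ) :
    delta₂ X (m + 1) N * theta X (m + 1) N = theta X m N * delta₂ X (m + 1) N := by
  unfold delta₂ theta
  by_cases h : Even m
  · have h' : ¬ Even (m + 1) := by simpa [Nat.even_add_one] using h
    have e : (m + 1) / 2 = m / 2 := by obtain ⟨k, rfl⟩ := h; omega
    rw [if_pos h, if_neg h', if_neg h', e, mul_smul_comm, smul_mul_assoc, sub_mul, barT_barR_barT,
      one_mul, mul_sub, mul_one, pow_succ, mul_neg_one]
    module
  · have h' : Even (m + 1) := by simpa [Nat.even_add_one] using h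
    have e : (m + 1) / 2 = m / 2 + 1 := by obtain ⟨k, hk⟩ := h'; omega
    rw [if_neg h, if_pos h', if_pos h', e, mul_smul_comm, smul_mul_assoc, mul_assoc, barT_barN,
      barN_barR]

variable {c : ℤ} {f : Family X Y}

theorem bar_theta (hf : IsDihedral f) (hfc : HasDegree c f) (m N N' : ℕ) :
    bar (m % 2) f N N' ∘ₗ theta X m N = theta Y m N' ∘ₗ bar (m % 2) f N N' := by
  unfold theta
  split_ifs with h
  · rw [Nat.even_iff.mp h, LinearMap.comp_smul, LinearMap.smul_comp, bar_zero_comp_R hf hfc]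
  · rw [Nat.not_even_iff.mp h, LinearMap.comp_smul, LinearMap.smul_comp, bar_one_comp_R_T hf hfc]

theorem bar_delta₂ (hf : IsDihedral f) (hfc : HasDegree c f) (m N N' : ℕ) :
    bar (m % 2) f N N' ∘ₗ delta₂ X (m + 1) N = delta₂ Y (m + 1) N' ∘ₗ bar ((m + 1) % 2) f N N' := by
  unfold delta₂
  by_cases h : Even m
  · have h' : ¬ Even (m + 1) := by simpa [Nat.even_add_one] using h
    rw [if_neg h', if_neg h', Nat.even_iff.mp h, Nat.not_even_iff.mp h', bar_zero_comp hf hfc]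
  · have h' : Even (m + 1) := by simpa [Nat.even_add_one] using h
    rw [if_pos h', if_pos h', Nat.not_even_iff.mp h, Nat.even_iff.mp h', bar_one_comp hf hfc]

end Lemmas

/-- The group `ℤ/2 = {1, ϑ}`, written multiplicatively. -/
abbrev G2 : Type := Multiplicative (ZMod 2)

theorem pow_mod_two {M : Type*} [Monoid M] {a : M} (h : a * a = 1) (n : ℕ) :
    a ^ (n % 2) = a ^ n := by
  conv_rhs => rw [← Nat.div_add_mod n 2, pow_add, pow_mul, pow_two, h, one_pow, one_mul]

theorem comp_pow {V W : Type*} [AddCommGroup V] [Module K V] [AddCommGroup W] [Module K W]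
    {θ : Module.End K V} {θ' : Module.End K W} {φ : V →ₗ[K] W} (h : φ ∘ₗ θ = θ' ∘ₗ φ) (n : ℕ) :
    φ ∘ₗ (θ ^ n) = (θ' ^ n) ∘ₗ φ := by
  induction n with
  | zero => rfl
  | succ n ih =>
    rw [pow_succ, pow_succ, Module.End.mul_eq_comp, Module.End.mul_eq_comp, ← LinearMap.comp_assoc,
      ih, LinearMap.comp_assoc, h, LinearMap.comp_assoc]

/-- The representation of `ℤ/2` in which the generator acts by a given involution `θ`. -/
def involutionRep {V : Type u} [AddCommGroup V] [Module K V] (θ : Module.End K V) (h : θ * θ = 1) :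
    Representation K G2 V where
  toFun g := θ ^ (Multiplicative.toAdd g).val
  map_one' := by simp
  map_mul' a b := by
    rw [toAdd_mul, ZMod.val_add, pow_mod_two h, pow_add]

/-- The `K[ℤ/2]`-module given by a `K`-module with an involution. -/
noncomputable def involutionModule {V : Type u} [AddCommGroup V] [Module K V] (θ : Module.End K V)
    (h : θ * θ = 1) : ModuleCat.{u} (MonoidAlgebra K G2) :=
  ModuleCat.of (MonoidAlgebra K G2) (involutionRep θ h).asModule

/-- A linear map that commutes with the involutions is a map of `K[ℤ/2]`-modules. -/
noncomputable def equivariantHom {V W : Type u} [AddCommGroup V] [Module K V] [AddCommGroup W]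
    [Module K W] {θ : Module.End K V} {h : θ * θ = 1} {θ' : Module.End K W} {h' : θ' * θ' = 1}
    (φ : V →ₗ[K] W) (hφ : φ ∘ₗ θ = θ' ∘ₗ φ) : involutionModule θ h ⟶ involutionModule θ' h' :=
  ModuleCat.ofHom (Representation.IntertwiningMap.equivLinearMapAsModule (involutionRep θ h)
    (involutionRep θ' h') ⟨φ, fun _ => comp_pow hφ _⟩)

section Lemmas

variable {V W U : Type u} [AddCommGroup V] [Module K V] [AddCommGroup W] [Module K W]
  [AddCommGroup U] [Module K U] {θ : Module.End K V} {h : θ * θ = 1} {θ' : Module.End K W}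
  {h' : θ' * θ' = 1} {θ'' : Module.End K U} {h'' : θ'' * θ'' = 1}

theorem equivariantHom_comp (φ : V →ₗ[K] W) (hφ : φ ∘ₗ θ = θ' ∘ₗ φ) (ψ : W →ₗ[K] U)
    (hψ : ψ ∘ₗ θ' = θ'' ∘ₗ ψ) :
    equivariantHom (h := h) (h' := h') φ hφ ≫ equivariantHom (h' := h'') ψ hψ =
      equivariantHom (ψ ∘ₗ φ)
        (by rw [LinearMap.comp_assoc, hφ, ← LinearMap.comp_assoc, hψ, LinearMap.comp_assoc]) :=
  rfl

theorem equivariantHom_eq_zero {φ : V →ₗ[K] W} (hφ : φ ∘ₗ θ = θ' ∘ₗ φ) (e : φ = 0) :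
    equivariantHom (h := h) (h' := h') φ hφ = 0 := by
  subst e; rfl

theorem equivariantHom_congr {φ ψ : V →ₗ[K] W} (e : φ = ψ) (hφ : φ ∘ₗ θ = θ' ∘ₗ φ)
    (hψ : ψ ∘ₗ θ = θ' ∘ₗ ψ) :
    equivariantHom (h := h) (h' := h') φ hφ = equivariantHom ψ hψ := by
  subst e; rfl

theorem equivariantHom_square {W' : Type u} [AddCommGroup W'] [Module K W']
    {θ₁ : Module.End K W'} {h₁ : θ₁ * θ₁ = 1} {φ : V →ₗ[K] W} (hφ : φ ∘ₗ θ = θ' ∘ₗ φ)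
    {ψ : W →ₗ[K] U} (hψ : ψ ∘ₗ θ' = θ'' ∘ₗ ψ) {φ' : V →ₗ[K] W'} (hφ' : φ' ∘ₗ θ = θ₁ ∘ₗ φ')
    {ψ' : W' →ₗ[K] U} (hψ' : ψ' ∘ₗ θ₁ = θ'' ∘ₗ ψ') (e : ψ ∘ₗ φ = ψ' ∘ₗ φ') :
    equivariantHom (h := h) (h' := h') φ hφ ≫ equivariantHom (h' := h'') ψ hψ =
      equivariantHom (h := h) (h' := h₁) φ' hφ' ≫ equivariantHom (h' := h'') ψ' hψ' := by
  rw [equivariantHom_comp, equivariantHom_comp]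
  exact equivariantHom_congr e _ _

end Lemmas

theorem bar_zero {X Y : DihedralBigraded.{u} K} (q N N' : ℕ) :
    bar q (0 : Family X Y) N N' = 0 := by
  refine LinearMap.ext fun x => funext fun j => ?_
  simp [bar, altSum]

/-- The column with index `m` of the cyclic bicomplex, before the sign is put in: the modules of
total degree `N`, with the differential `b` if `m` is even and `b'` if `m` is odd. -/
noncomputable def cyclicColumn (X : DFModule.{u} K) (m : ℕ) :
    ChainComplex (ModuleCat.{u} (MonoidAlgebra K G2)) ℕ where
  X N := involutionModule (theta X.toDihedralBigraded m N) (theta_theta _ m N)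
  d N N' := equivariantHom (bar (m % 2) X.face N N') (bar_theta X.isDihedral X.hasDegree m N N')
  shape N N' hN := by
    have : bar (m % 2) X.face N N' = 0 := bar_eq_zero X.hasDegree _ (by
      simp only [ComplexShape.down_Rel] at hN; omega)
    exact equivariantHom_eq_zero _ this
  d_comp_d' N N' N'' hN _ := by
    simp only [ComplexShape.down_Rel] at hN
    have : bar (m % 2) X.face N' N'' ∘ₗ bar (m % 2) X.face N N' = 0 := by
      rw [← bar_shuffle (by omega) X.hasDegree (by omega), X.face_face, bar_zero]
    rw [equivariantHom_comp]
    exact equivariantHom_eq_zero _ this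

/-- The horizontal differential from the column with index `m` to the column with index `m'`, in total
degree `N`: it is `1 - T` if `m = m' + 1` is odd, `N` if `m = m' + 1` is even, and zero if
`m ≠ m' + 1`. -/
def rowMap (X : DihedralBigraded.{u} K) (m m' N : ℕ) : Module.End K (Bar X N) :=
  if m' + 1 = m then delta₂ X m N else 0

theorem rowMap_theta (X : DihedralBigraded.{u} K) (m m' N : ℕ) :
    rowMap X m m' N ∘ₗ theta X m N = theta X m' N ∘ₗ rowMap X m m' N := by
  unfold rowMap
  split_ifs with h
  · subst h
    exact delta₂_theta X m' N
  · simp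

theorem rowMap_rowMap (X : DihedralBigraded.{u} K) (m m' m'' N : ℕ) :
    rowMap X m' m'' N ∘ₗ rowMap X m m' N = 0 := by
  unfold rowMap
  split_ifs with h h'
  · subst h
    subst h'
    exact delta₂_delta₂ X (m'' + 1) N
  all_goals simp

theorem bar_rowMap {X Y : DihedralBigraded.{u} K} {c : ℤ} {f : Family X Y} (hf : IsDihedral f)
    (hfc : HasDegree c f) (m m' N N' : ℕ) :
    bar (m' % 2) f N N' ∘ₗ rowMap X m m' N = rowMap Y m m' N' ∘ₗ bar (m % 2) f N N' := by
  unfold rowMap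
  split_ifs with h
  · subst h
    exact bar_delta₂ hf hfc m' N N'
  · simp

/-- The horizontal differential as a chain map between columns. -/
noncomputable def cyclicRow (X : DFModule.{u} K) (m m' : ℕ) :
    cyclicColumn X m ⟶ cyclicColumn X m' where
  f N := equivariantHom (rowMap X.toDihedralBigraded m m' N) (rowMap_theta _ m m' N)
  comm' N N' _ := equivariantHom_square (rowMap_theta _ m m' N)
    (bar_theta X.isDihedral X.hasDegree m' N N') (bar_theta X.isDihedral X.hasDegree m N N')
    (rowMap_theta _ m m' N') (bar_rowMap X.isDihedral X.hasDegree m m' N N')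

/-- The bicomplex `(C(X), δ₁, δ₂)` of `K[ℤ/2]`-modules of a dihedral module with `∞`-simplicial
faces; the first index is that of the column. The sign in `δ₁` (which is `b` on even columns and
`-b'` on odd ones) is put in when the total complex is formed. -/
noncomputable def cyclicBicomplex (X : DFModule.{u} K) :
    HomologicalComplex₂ (ModuleCat.{u} (MonoidAlgebra K G2)) (ComplexShape.down ℕ)
      (ComplexShape.down ℕ) where
  X m := cyclicColumn X m
  d m m' := cyclicRow X m m'
  shape m m' h := by
    ext1 N
    exact equivariantHom_eq_zero (rowMap_theta _ m m' N) (if_neg h)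
  d_comp_d' m m' m'' _ _ := by
    ext1 N
    rw [HomologicalComplex.comp_f]
    exact (equivariantHom_comp _ (rowMap_theta _ m m' N) _ (rowMap_theta _ m' m'' N)).trans
      (equivariantHom_eq_zero _ (rowMap_rowMap _ m m' m'' N))

/-- The chain map between the columns with index `m` that is induced by a morphism `f`:
it is `f̄₀` for even `m` and `f̄₁` for odd `m`. -/
noncomputable def cyclicColumnMap {X Y : DFModule.{u} K} (f : X ⟶ Y) (m : ℕ) :
    cyclicColumn X m ⟶ cyclicColumn Y m where
  f N := equivariantHom (bar (m % 2) (DFModule.Hom.family f) N N)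
    (bar_theta (DFModule.Hom.isDihedral f) (DFModule.Hom.hasDegree f) m N N)
  comm' N N' h := by
    simp only [ComplexShape.down_Rel] at h
    simp only [cyclicColumn]
    rw [equivariantHom_comp, equivariantHom_comp]
    refine equivariantHom_congr ?_ _ _
    rw [← bar_shuffle (by omega) (DFModule.Hom.hasDegree f) (by simp),
      ← bar_shuffle (by omega) X.hasDegree (by omega), DFModule.Hom.face_comm f]

/-- The map of bicomplexes `C(f)`. -/
noncomputable def cyclicBicomplexMap {X Y : DFModule.{u} K} (f : X ⟶ Y) :
    cyclicBicomplex X ⟶ cyclicBicomplex Y where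
  f m := cyclicColumnMap f m
  comm' m m' _ := by
    ext1 N
    have hf := DFModule.Hom.isDihedral f
    have hf' := DFModule.Hom.hasDegree f
    exact equivariantHom_square (bar_theta hf hf' m N N) (rowMap_theta _ m m' N)
      (rowMap_theta _ m m' N) (bar_theta hf hf' m' N N) (bar_rowMap hf hf' m m' N N).symm

/-- The trivial `K[ℤ/2]`-module `K`. -/
noncomputable def trivialModule (K : Type u) [CommRing K] : ModuleCat.{u} (MonoidAlgebra K G2) :=
  ModuleCat.of (MonoidAlgebra K G2) (Representation.trivial K G2 K).asModule

/-- The graded `K`-module of homology of a complex of `K[ℤ/2]`-modules. -/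
noncomputable def gradedHomology (K : Type u) [CommRing K] :
    ChainComplex (ModuleCat.{u} (MonoidAlgebra K G2)) ℕ ⥤ GradedObject ℕ (ModuleCat.{u} K) :=
  (ModuleCat.restrictScalars (algebraMap K (MonoidAlgebra K G2))).mapHomologicalComplex _ ⋙
    HomologicalComplex.gradedHomologyFunctor (ModuleCat.{u} K) (ComplexShape.down ℕ)

/-- The hyperhomology `H(ℤ/2; C)` of the group `ℤ/2` with coefficients in a bicomplex `C` of
`K[ℤ/2]`-modules, computed with the projective resolution `P` of the trivial module: the homology
of the total complex of the triple complex `C ⊗_{K[ℤ/2]} P`, whose third differential on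
`C_{m,n} ⊗ P_l` is `(-1)^{n+m} 1 ⊗ d`. -/
noncomputable def hyperhomology (P : ProjectiveResolution (trivialModule K)) :
    HomologicalComplex₂ (ModuleCat.{u} (MonoidAlgebra K G2)) (ComplexShape.down ℕ)
      (ComplexShape.down ℕ) ⥤ GradedObject ℕ (ModuleCat.{u} K) :=
  HomologicalComplex₂.totalFunctor _ _ _ (ComplexShape.down ℕ) ⋙
    MonoidalCategory.tensorRight P.complex ⋙ gradedHomology K

/-- The element `1 + (-1)^l ϑ` of the group algebra. -/
noncomputable def standardCoeff (K : Type u) [CommRing K] (l : ℕ) : MonoidAlgebra K G2 :=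
  1 + (-1) ^ l * MonoidAlgebra.of K G2 (Multiplicative.ofAdd 1)

theorem standardCoeff_mul (K : Type u) [CommRing K] (l : ℕ) :
    standardCoeff K l * standardCoeff K (l + 1) = 0 := by
  have h : MonoidAlgebra.of K G2 (Multiplicative.ofAdd 1) *
      MonoidAlgebra.of K G2 (Multiplicative.ofAdd 1) = 1 := by
    rw [← map_mul]
    exact map_one _
  have h' : ((-1 : MonoidAlgebra K G2) ^ l) * (-1) ^ l = 1 := by
    rw [← pow_add, Even.neg_one_pow (Even.add_self l)]
  rw [standardCoeff, standardCoeff, pow_succ]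
  linear_combination (-1 : MonoidAlgebra K G2) * h' *
    (MonoidAlgebra.of K G2 (Multiplicative.ofAdd 1) * MonoidAlgebra.of K G2 (Multiplicative.ofAdd 1)) - h

/-- For a complex `C` of `K[ℤ/2]`-modules, the bicomplex with the columns `D_{p,l} = C_p`, `l ≥ 0`,
and the differentials `d` of `C` and `1 + (-1)^l ϑ : D_{p,l} → D_{p,l-1}`. -/
noncomputable def standardBicomplex (C : ChainComplex (ModuleCat.{u} (MonoidAlgebra K G2)) ℕ) :
    HomologicalComplex₂ (ModuleCat.{u} (MonoidAlgebra K G2)) (ComplexShape.down ℕ)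
      (ComplexShape.down ℕ) :=
  HomologicalComplex₂.ofGradedObject _ _ (fun i => C.X i.1) (fun p p' _ => C.d p p')
    (fun _ l l' => if l' + 1 = l then standardCoeff K l • 𝟙 _ else 0)
    (fun p p' h _ => C.shape p p' h)
    (fun _ l l' h => if_neg h)
    (fun p p' p'' _ => C.d_comp_d p p' p'')
    (fun _ l l' l'' => by
      split_ifs with h h'
      · subst h'
        subst h
        rw [Linear.smul_comp, Linear.comp_smul, smul_smul, mul_comm, standardCoeff_mul, zero_smul]
      all_goals simp)
    (fun p p' l l' => by
      split_ifs with h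
      · simp
      · simp)

/-- The map of bicomplexes induced by a chain map. -/
noncomputable def standardBicomplexMap {C C' : ChainComplex (ModuleCat.{u} (MonoidAlgebra K G2)) ℕ}
    (φ : C ⟶ C') : standardBicomplex C ⟶ standardBicomplex C' :=
  HomologicalComplex₂.homMk (fun i => φ.f i.1) (fun p p' _ _ => φ.comm p p')
    (fun p l l' _ => by
      change φ.f p ≫ (if l' + 1 = l then standardCoeff K l • 𝟙 _ else 0) =
        (if l' + 1 = l then standardCoeff K l • 𝟙 _ else 0) ≫ φ.f p
      split_ifs <;> simp)

/-- The dihedral homology `HD(X)`: the homology of the total complex of the triple complex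
`D(X)_{n,m,l} = C(X)_{n,m}`, `n, m, l ≥ 0`, with the differentials `δ₁`, `δ₂` of `C(X)` and
`δ₃ = (-1)^{n+m} (1 + (-1)^l ϑ) : D(X)_{n,m,l} → D(X)_{n,m,l-1}`. -/
noncomputable def dihedralHomology (X : DFModule.{u} K) : GradedObject ℕ (ModuleCat.{u} K) :=
  (gradedHomology K).obj
    ((standardBicomplex ((cyclicBicomplex X).total (ComplexShape.down ℕ))).total
      (ComplexShape.down ℕ))

/-- The map of dihedral homology induced by a morphism `f`, through the map `C(f)`. -/
noncomputable def dihedralHomologyMap {X Y : DFModule.{u} K} (f : X ⟶ Y) :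
    dihedralHomology X ⟶ dihedralHomology Y :=
  (gradedHomology K).map
    (HomologicalComplex₂.total.map
      (standardBicomplexMap
        (HomologicalComplex₂.total.map (cyclicBicomplexMap f) (ComplexShape.down ℕ)))
      (ComplexShape.down ℕ))

end Dihedral

/-!
The passage from a family `f` to the maps `f̄₀`, `f̄₁` turns the shuffle product into composition
(`bar_shuffle`). Hence `X ↦ C(X)` is a functor to bicomplexes of `K[ℤ/2]`-modules, and so is `HD`
after taking total complexes and homology.

The complex `⋯ → K[ℤ/2] → K[ℤ/2]` with differentials `1 + (-1)^l ϑ` is a projective resolution of the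
trivial module (`standardResolution`): writing elements as `a + b ϑ`, the kernel of each differential
and of the augmentation is visibly the image of the next one. All its terms are the unit of the
tensor product, so the right unitors identify `C ⊗ standardComplex K` with the total complex that
defines `HD` (`standardTotalIso`), naturally in `C`. Any other resolution `P` is homotopy equivalent
to this one, and tensoring preserves homotopies, which gives the natural isomorphism of `HD` with
hyperhomology (`dihedralHomologyIso`).

By `bar_shuffle` again, a homotopy `h` of morphisms gives maps `h̄₀`, `h̄₁` that are chain homotopies
on the columns of the cyclic bicomplex, and these commute with `ϑ` and with the horizontal differentials
`1 - T` and `N`, because `h` is compatible with `t` and `r`. Such column homotopies assemble, with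
signs, to an equivariant homotopy of total complexes (`HomologicalComplex₂.totalHomotopy`). So
homotopic morphisms induce the same map of hyperhomology, hence of `HD`, and a homotopy inverse
induces an inverse.
-/

/-! ### Homotopies between maps of total complexes -/

namespace HomologicalComplex₂

open Limits

variable {C I₁ I₂ J : Type*} [Category* C] [Preadditive C] {c₁ : ComplexShape I₁}
  {c₂ : ComplexShape I₂} {K L : HomologicalComplex₂ C c₁ c₂} {φ ψ : K ⟶ L}
  (c : ComplexShape J) [TotalComplexShape c₁ c₂ c] [DecidableEq J] [K.HasTotal c] [L.HasTotal c]
  (h : ∀ i, Homotopy (φ.f i) (ψ.f i))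

/-- The degree `j` to `j'` component of the homotopy of total complexes: on the summand `(i₁, i₂)`
it is the homotopy of the column `i₁`, with the sign `ε₂` that the vertical differential entering
`(i₁, i₂)` carries in the total complex. -/
noncomputable def totalHomotopyHom (j j' : J) : (K.total c).X j ⟶ (L.total c).X j' :=
  K.totalDesc fun i₁ i₂ _ => ComplexShape.ε₂ c₁ c₂ c (i₁, c₂.prev i₂) •
    (h i₁).hom i₂ (c₂.prev i₂) ≫ L.ιTotalOrZero c i₁ (c₂.prev i₂) j'

theorem ι_totalHomotopyHom {i₁ : I₁} {i₂ i₂' : I₂} {j : J} (j' : J)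
    (hj : ComplexShape.π c₁ c₂ c (i₁, i₂') = j) (h' : c₂.prev i₂' = i₂) :
    K.ιTotal c i₁ i₂' j hj ≫ totalHomotopyHom c h j j' =
      ComplexShape.ε₂ c₁ c₂ c (i₁, i₂) •
        (h i₁).hom i₂' i₂ ≫ L.ιTotalOrZero c i₁ i₂ j' := by
  subst h'
  simp [totalHomotopyHom]

theorem ι_totalHomotopyHom_of_rel {i₁ : I₁} {i₂ i₂' : I₂} {j j' : J} (hi : c₂.Rel i₂ i₂')
    (hj : ComplexShape.π c₁ c₂ c (i₁, i₂') = j) (hj' : ComplexShape.π c₁ c₂ c (i₁, i₂) = j') :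
    K.ιTotal c i₁ i₂' j hj ≫ totalHomotopyHom c h j j' =
      ComplexShape.ε₂ c₁ c₂ c (i₁, i₂) • (h i₁).hom i₂' i₂ ≫ L.ιTotal c i₁ i₂ j' hj' := by
  rw [ι_totalHomotopyHom c h j' hj (c₂.prev_eq' hi), ιTotalOrZero_eq]

theorem ι_totalHomotopyHom_of_not_rel {i₁ : I₁} {i₂ : I₂} {j : J} (j' : J)
    (hi : ¬ c₂.Rel (c₂.prev i₂) i₂) (hj : ComplexShape.π c₁ c₂ c (i₁, i₂) = j) :
    K.ιTotal c i₁ i₂ j hj ≫ totalHomotopyHom c h j j' = 0 := by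
  rw [ι_totalHomotopyHom c h j' hj rfl, (h i₁).zero _ _ hi, zero_comp, smul_zero]

theorem totalHomotopyHom_zero (j j' : J) (hj : ¬ c.Rel j' j) : totalHomotopyHom c h j j' = 0 := by
  refine total.hom_ext _ fun i₁ i₂ hi => ?_
  rw [comp_zero]
  by_cases h₂ : c₂.Rel (c₂.prev i₂) i₂
  · rw [ι_totalHomotopyHom c h j' hi rfl, ιTotalOrZero_eq_zero, comp_zero, smul_zero]
    intro h₃
    apply hj
    rw [← hi, ← h₃]
    exact ComplexShape.rel_π₂ c₁ c i₁ h₂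
  · exact ι_totalHomotopyHom_of_not_rel c h j' h₂ hi

theorem d₂_totalHomotopyHom (i₁ : I₁) (i₂ : I₂) (j : J)
    (hj : ComplexShape.π c₁ c₂ c (i₁, i₂) = j) :
    K.d₂ c i₁ i₂ (c.next j) ≫ totalHomotopyHom c h (c.next j) j =
      dNext i₂ (h i₁).hom ≫ L.ιTotal c i₁ i₂ j hj := by
  by_cases h₂ : c₂.Rel i₂ (c₂.next i₂)
  · have hn : ComplexShape.π c₁ c₂ c (i₁, c₂.next i₂) = c.next j := by
      rw [← hj, ComplexShape.next_π₂ c₁ c i₁ h₂]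
    rw [d₂_eq _ _ _ h₂ _ hn, Linear.units_smul_comp, Category.assoc,
      ι_totalHomotopyHom_of_rel c h h₂ hn hj, Linear.comp_units_smul, smul_smul,
      Int.units_mul_self, one_smul, dNext_eq _ h₂, Category.assoc]
  · rw [d₂_eq_zero _ _ _ _ _ h₂, zero_comp, dNext_eq_dFrom_fromNext,
      HomologicalComplex.dFrom_eq_zero _ h₂, zero_comp, zero_comp]

theorem ι_totalHomotopyHom_D₂ (i₁ : I₁) (i₂ : I₂) (j : J)
    (hj : ComplexShape.π c₁ c₂ c (i₁, i₂) = j) :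
    K.ιTotal c i₁ i₂ j hj ≫ totalHomotopyHom c h j (c.prev j) ≫ L.D₂ c (c.prev j) j =
      prevD i₂ (h i₁).hom ≫ L.ιTotal c i₁ i₂ j hj := by
  by_cases h₂ : c₂.Rel (c₂.prev i₂) i₂
  · have hp : ComplexShape.π c₁ c₂ c (i₁, c₂.prev i₂) = c.prev j := by
      rw [← hj, ComplexShape.prev_π₂ c₁ c i₁ h₂]
    rw [← Category.assoc, ι_totalHomotopyHom_of_rel c h h₂ hj hp, Linear.units_smul_comp,
      Category.assoc, ι_D₂, d₂_eq _ _ _ h₂ _ hj, Linear.comp_units_smul, smul_smul,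
      Int.units_mul_self, one_smul, prevD_eq _ h₂, Category.assoc]
  · rw [← Category.assoc, ι_totalHomotopyHom_of_not_rel c h _ h₂ hj, zero_comp,
      prevD_eq_toPrev_dTo, HomologicalComplex.dTo_eq_zero _ h₂, comp_zero, zero_comp]

/-- The horizontal differential anticommutes with the total homotopy, since a horizontal and a
vertical step carry opposite signs in the two orders. -/
theorem d₁_totalHomotopyHom
    (hh : ∀ i₁ i₁' i₂ i₂', (h i₁).hom i₂ i₂' ≫ (L.d i₁ i₁').f i₂' =
      (K.d i₁ i₁').f i₂ ≫ (h i₁').hom i₂ i₂') (i₁ : I₁) (i₂ : I₂) (j : J)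
    (hj : ComplexShape.π c₁ c₂ c (i₁, i₂) = j) :
    K.d₁ c i₁ i₂ (c.next j) ≫ totalHomotopyHom c h (c.next j) j =
      - K.ιTotal c i₁ i₂ j hj ≫ totalHomotopyHom c h j (c.prev j) ≫ L.D₁ c (c.prev j) j := by
  by_cases h₁ : c₁.Rel i₁ (c₁.next i₁)
  · have hn : ComplexShape.π c₁ c₂ c (c₁.next i₁, i₂) = c.next j := by
      rw [← hj, ComplexShape.next_π₁ c₂ c h₁ i₂]
    by_cases h₂ : c₂.Rel (c₂.prev i₂) i₂
    · have hp : ComplexShape.π c₁ c₂ c (i₁, c₂.prev i₂) = c.prev j := by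
        rw [← hj, ComplexShape.prev_π₂ c₁ c i₁ h₂]
      have hj' : ComplexShape.π c₁ c₂ c (c₁.next i₁, c₂.prev i₂) = j := by
        rw [← ComplexShape.next_π₁ c₂ c h₁ (c₂.prev i₂), ← hj]
        exact c.next_eq' (ComplexShape.rel_π₂ c₁ c i₁ h₂)
      rw [d₁_eq _ _ h₁ _ _ hn, Linear.units_smul_comp, Category.assoc,
        ι_totalHomotopyHom_of_rel c h h₂ hn hj', ← Category.assoc (K.ιTotal c i₁ i₂ j hj),
        ι_totalHomotopyHom_of_rel c h h₂ hj hp, Linear.units_smul_comp,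
        Category.assoc, ι_D₁, d₁_eq _ _ h₁ _ _ hj', Linear.comp_units_smul,
        Linear.comp_units_smul, smul_smul, smul_smul, reassoc_of% (hh i₁ (c₁.next i₁)),
        ← Units.neg_smul]
      congr 1
      have e := ComplexShape.ε₁_ε₂ c h₁ h₂
      rw [mul_comm, mul_comm (ComplexShape.ε₂ c₁ c₂ c (i₁, c₂.prev i₂)), e, neg_mul, neg_neg]
    · rw [← Category.assoc (K.ιTotal c i₁ i₂ j hj), ι_totalHomotopyHom_of_not_rel c h _ h₂ hj,
        zero_comp, neg_zero, d₁_eq _ _ h₁ _ _ hn, Linear.units_smul_comp, Category.assoc,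
        ι_totalHomotopyHom_of_not_rel c h _ h₂ hn, comp_zero, smul_zero]
  · rw [d₁_eq_zero _ _ _ _ _ h₁, zero_comp, zero_eq_neg]
    by_cases h₂ : c₂.Rel (c₂.prev i₂) i₂
    · have hp : ComplexShape.π c₁ c₂ c (i₁, c₂.prev i₂) = c.prev j := by
        rw [← hj, ComplexShape.prev_π₂ c₁ c i₁ h₂]
      rw [← Category.assoc, ι_totalHomotopyHom_of_rel c h h₂ hj hp, Linear.units_smul_comp,
        Category.assoc, ι_D₁, d₁_eq_zero _ _ _ _ _ h₁, comp_zero, smul_zero]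
    · rw [← Category.assoc, ι_totalHomotopyHom_of_not_rel c h _ h₂ hj, zero_comp]

/-- Homotopies between the columns of two maps of bicomplexes that commute with the horizontal
differentials assemble to a homotopy between the maps of total complexes. -/
noncomputable def totalHomotopy
    (hh : ∀ i₁ i₁' i₂ i₂', (h i₁).hom i₂ i₂' ≫ (L.d i₁ i₁').f i₂' =
      (K.d i₁ i₁').f i₂ ≫ (h i₁').hom i₂ i₂') :
    Homotopy (total.map φ c) (total.map ψ c) where
  hom := totalHomotopyHom c h
  zero := totalHomotopyHom_zero c h
  comm j := by
    refine total.hom_ext _ fun i₁ i₂ hi => ?_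
    rw [ιTotal_map, (h i₁).comm i₂, Preadditive.comp_add, Preadditive.comp_add, ιTotal_map,
      dNext_eq_dFrom_fromNext, prevD_eq_toPrev_dTo]
    change _ = K.ιTotal c i₁ i₂ j hi ≫ (K.total c).d j (c.next j) ≫
      totalHomotopyHom c h (c.next j) j + K.ιTotal c i₁ i₂ j hi ≫
        totalHomotopyHom c h j (c.prev j) ≫ (L.total c).d (c.prev j) j + _
    rw [total_d, total_d, Preadditive.add_comp, Preadditive.comp_add, Preadditive.comp_add,
      Preadditive.add_comp, Preadditive.add_comp, Preadditive.comp_add,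
      ← Category.assoc _ (K.D₁ _ _ _), ← Category.assoc _ (K.D₂ _ _ _), ι_D₁, ι_D₂,
      ι_totalHomotopyHom_D₂, d₂_totalHomotopyHom _ _ _ _ _ hi,
      d₁_totalHomotopyHom _ _ hh _ _ _ hi,
      dNext_eq_dFrom_fromNext, prevD_eq_toPrev_dTo]
    abel

end HomologicalComplex₂

namespace Dihedral

open MonoidalCategory

variable {K : Type u} [CommRing K]

/-! ### Functoriality of dihedral homology -/

theorem cyclicColumnMap_id (X : DFModule.{u} K) (m : ℕ) :
    cyclicColumnMap (𝟙 X) m = 𝟙 (cyclicColumn X m) :=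
  HomologicalComplex.hom_ext _ _ fun N => by
    have e : bar (m % 2) (DFModule.Hom.family (𝟙 X)) N N = LinearMap.id := bar_idFamily _ N
    exact equivariantHom_congr e (bar_theta (DFModule.Hom.isDihedral (𝟙 X))
      (DFModule.Hom.hasDegree (𝟙 X)) m N N) rfl

theorem cyclicColumnMap_comp {X Y Z : DFModule.{u} K} (f : X ⟶ Y) (g : Y ⟶ Z) (m : ℕ) :
    cyclicColumnMap (f ≫ g) m = cyclicColumnMap f m ≫ cyclicColumnMap g m :=
  HomologicalComplex.hom_ext _ _ fun N => by
    have e : bar (m % 2) (DFModule.Hom.family (f ≫ g)) N N =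
        bar (m % 2) (DFModule.Hom.family g) N N ∘ₗ bar (m % 2) (DFModule.Hom.family f) N N :=
      bar_shuffle (by omega) (DFModule.Hom.hasDegree f) (by simp) N
    have hc := bar_theta (DFModule.Hom.isDihedral (f ≫ g)) (DFModule.Hom.hasDegree (f ≫ g)) m N N
    exact (equivariantHom_congr e hc (by rw [← e]; exact hc)).trans
      (equivariantHom_comp _ (bar_theta (DFModule.Hom.isDihedral f) (DFModule.Hom.hasDegree f) m N N)
        _ (bar_theta (DFModule.Hom.isDihedral g) (DFModule.Hom.hasDegree g) m N N)).symm

theorem cyclicBicomplexMap_id (X : DFModule.{u} K) :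
    cyclicBicomplexMap (𝟙 X) = 𝟙 (cyclicBicomplex X) :=
  HomologicalComplex.hom_ext _ _ (cyclicColumnMap_id X)

theorem cyclicBicomplexMap_comp {X Y Z : DFModule.{u} K} (f : X ⟶ Y) (g : Y ⟶ Z) :
    cyclicBicomplexMap (f ≫ g) = cyclicBicomplexMap f ≫ cyclicBicomplexMap g :=
  HomologicalComplex.hom_ext _ _ (cyclicColumnMap_comp f g)

theorem standardBicomplexMap_id (C : ChainComplex (ModuleCat.{u} (MonoidAlgebra K G2)) ℕ) :
    standardBicomplexMap (𝟙 C) = 𝟙 (standardBicomplex C) := rfl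

theorem standardBicomplexMap_comp {C D E : ChainComplex (ModuleCat.{u} (MonoidAlgebra K G2)) ℕ}
    (φ : C ⟶ D) (ψ : D ⟶ E) :
    standardBicomplexMap (φ ≫ ψ) = standardBicomplexMap φ ≫ standardBicomplexMap ψ := rfl

/-- Dihedral homology as a functor on dihedral modules with `∞`-simplicial faces. -/
noncomputable def dihedralHomologyFunctor (K : Type u) [CommRing K] :
    DFModule.{u} K ⥤ GradedObject ℕ (ModuleCat.{u} K) where
  obj := dihedralHomology
  map := dihedralHomologyMap
  map_id X := by
    rw [dihedralHomologyMap, cyclicBicomplexMap_id, HomologicalComplex₂.total.map_id,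
      standardBicomplexMap_id, HomologicalComplex₂.total.map_id]
    exact (gradedHomology K).map_id _
  map_comp f g := by
    rw [dihedralHomologyMap, cyclicBicomplexMap_comp, HomologicalComplex₂.total.map_comp,
      standardBicomplexMap_comp, HomologicalComplex₂.total.map_comp]
    exact (gradedHomology K).map_comp _ _

/-! ### Homotopies of morphisms -/

theorem bar_add {X Y : DihedralBigraded.{u} K} (q : ℕ) (f g : Family X Y) (N N' : ℕ) :
    bar q (f + g) N N' = bar q f N N' + bar q g N N' := by
  refine LinearMap.ext fun x => funext fun j => ?_
  simp [bar, altSum, Finset.sum_add_distrib, smul_add]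

/-- A family of degree `-1` has no component out of total degree `0`; this complements
`bar_shuffle`, whose intermediate total degree would be `-1` here. -/
theorem bar_shuffle_zero {X Y Z : DihedralBigraded.{u} K} {f : Family X Y} {g : Family Y Z}
    {q : ℕ} (hq : q ≤ 1) (hf : HasDegree (-1) f) (N'' : ℕ) :
    bar q (shuffle (-1) g f) 0 N'' = 0 := by
  refine LinearMap.ext fun x => funext fun j => ?_
  simp only [bar, LinearMap.pi_apply, LinearMap.sum_apply, LinearMap.zero_apply, Pi.zero_apply]
  refine Finset.sum_eq_zero fun i _ => ?_
  rw [altSum_shuffle hq hf, Finset.sum_eq_zero]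
  · rfl
  · intro B _
    rw [signed, hf.eq_zero, smul_zero, LinearMap.comp_zero]
    have := i.2
    rintro ⟨-, h1, h2⟩
    omega

section

variable {X Y : DFModule.{u} K} {f g : X ⟶ Y}

/-- The relation `∂ * h + h * ∂ = f - g` in positive total degree. -/
theorem bar_homotopy_succ (h : DFModule.Homotopy f g) {q : ℕ} (hq : q ≤ 1) (N : ℕ) :
    bar q (DFModule.Hom.family f) (N + 1) (N + 1) =
      bar q h.family N (N + 1) ∘ₗ bar q X.face (N + 1) N +
        bar q Y.face (N + 2) (N + 1) ∘ₗ bar q h.family (N + 1) (N + 2) +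
        bar q (DFModule.Hom.family g) (N + 1) (N + 1) := by
  rw [← bar_shuffle hq X.hasDegree (by push_cast; ring), ← bar_shuffle hq h.hasDegree
    (by push_cast; ring), ← bar_add, ← bar_add, add_comm (shuffle (-1) _ _), h.face_add,
    sub_add_cancel]

theorem bar_homotopy_zero (h : DFModule.Homotopy f g) {q : ℕ} (hq : q ≤ 1) :
    bar q (DFModule.Hom.family f) 0 0 =
      bar q Y.face 1 0 ∘ₗ bar q h.family 0 1 + bar q (DFModule.Hom.family g) 0 0 := by
  rw [← bar_shuffle hq h.hasDegree (by norm_num), ← bar_add,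
    ← add_zero (bar q (_ + _) 0 0), ← bar_shuffle_zero (g := h.family) hq X.hasDegree 0, ← bar_add,
    add_right_comm, h.face_add, sub_add_cancel]

/-- The component of the chain homotopy between columns that is induced by a homotopy `h`: the map
`h̄₀` for even `m` and `h̄₁` for odd `m`. -/
noncomputable def cyclicColumnHomotopyHom (h : DFModule.Homotopy f g) (m N N' : ℕ) :
    (cyclicColumn X m).X N ⟶ (cyclicColumn Y m).X N' :=
  equivariantHom (bar (m % 2) h.family N N') (bar_theta h.isDihedral h.hasDegree m N N')

/-- The homotopy between the maps of columns that is induced by a homotopy of morphisms. -/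
noncomputable def cyclicColumnHomotopy (h : DFModule.Homotopy f g) (m : ℕ) :
    Homotopy (cyclicColumnMap f m) (cyclicColumnMap g m) where
  hom := cyclicColumnHomotopyHom h m
  zero N N' hN := equivariantHom_eq_zero _ (bar_eq_zero h.hasDegree _ (by
    simp only [ComplexShape.down_Rel] at hN; omega))
  comm N := by
    have hf := bar_theta (DFModule.Hom.isDihedral f) (DFModule.Hom.hasDegree f) m
    cases N with
    | zero =>
      rw [Homotopy.dNext_zero_chainComplex, Homotopy.prevD_chainComplex, zero_add]
      have e := bar_homotopy_zero h (q := m % 2) (by omega)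
      exact (equivariantHom_congr e (hf 0 0) (by rw [← e]; exact hf 0 0)).trans
        (ModuleCat.hom_ext (LinearMap.ext fun _ => rfl))
    | succ N =>
      rw [Homotopy.dNext_succ_chainComplex, Homotopy.prevD_chainComplex]
      have e := bar_homotopy_succ h (q := m % 2) (by omega) N
      exact (equivariantHom_congr e (hf _ _) (by rw [← e]; exact hf _ _)).trans
        (ModuleCat.hom_ext (LinearMap.ext fun _ => rfl))

/-- Homotopic morphisms induce homotopic maps of the total complexes of the cyclic bicomplexes. -/
noncomputable def totalCyclicHomotopy (h : DFModule.Homotopy f g) :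
    Homotopy (HomologicalComplex₂.total.map (cyclicBicomplexMap f) (ComplexShape.down ℕ))
      (HomologicalComplex₂.total.map (cyclicBicomplexMap g) (ComplexShape.down ℕ)) :=
  HomologicalComplex₂.totalHomotopy _ (cyclicColumnHomotopy h) fun m m' N N' =>
    equivariantHom_square (bar_theta h.isDihedral h.hasDegree m N N') (rowMap_theta _ m m' N')
      (rowMap_theta _ m m' N) (bar_theta h.isDihedral h.hasDegree m' N N')
      (bar_rowMap h.isDihedral h.hasDegree m m' N N').symm

end

/-! ### The periodic resolution of the trivial module -/

/-- Every element of `K[ℤ/2]` has the form `a + b ϑ`. -/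
theorem exists_eq_add_theta (x : MonoidAlgebra K G2) :
    ∃ a b : K, x = a • 1 + b • MonoidAlgebra.of K G2 (Multiplicative.ofAdd 1) := by
  refine ⟨x.coeff 1, x.coeff (Multiplicative.ofAdd 1), ?_⟩
  ext g
  have hg : g = 1 ∨ g = Multiplicative.ofAdd (1 : ZMod 2) := by
    revert g; decide
  rcases hg with rfl | rfl <;> simp [MonoidAlgebra.one_def]

theorem add_theta_eq_zero {a b : K}
    (h : a • 1 + b • MonoidAlgebra.of K G2 (Multiplicative.ofAdd 1) = 0) : a = 0 ∧ b = 0 := by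
  constructor
  · simpa [MonoidAlgebra.one_def] using congrArg (fun x => x.coeff 1) h
  · simpa [MonoidAlgebra.one_def] using
      congrArg (fun x => x.coeff (Multiplicative.ofAdd (1 : ZMod 2))) h

theorem theta_mul_theta : MonoidAlgebra.of K G2 (Multiplicative.ofAdd 1) *
    MonoidAlgebra.of K G2 (Multiplicative.ofAdd 1) = 1 := by
  rw [← map_mul]
  exact map_one _

/-- The annihilator of `1 + (-1)^l ϑ` is generated by `1 + (-1)^{l+1} ϑ`. -/
theorem exists_standardCoeff_mul (l : ℕ) {x : MonoidAlgebra K G2}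
    (hx : standardCoeff K l * x = 0) : ∃ y, standardCoeff K (l + 1) * y = x := by
  obtain ⟨a, b, rfl⟩ := exists_eq_add_theta x
  have h : (a + (-1) ^ l * b) • (1 : MonoidAlgebra K G2) +
      (b + (-1) ^ l * a) • MonoidAlgebra.of K G2 (Multiplicative.ofAdd 1) = 0 := by
    rw [← hx, standardCoeff]
    simp only [Algebra.smul_def, map_add, map_mul, map_pow, map_neg, map_one]
    linear_combination -(-1) ^ l * algebraMap K (MonoidAlgebra K G2) b * theta_mul_theta (K := K)
  -- Now `b = -(-1)^l a`, so `x = a (1 + (-1)^{l+1} ϑ)`.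
  obtain ⟨-, h2⟩ := add_theta_eq_zero h
  refine ⟨a • 1, ?_⟩
  rw [eq_neg_of_add_eq_zero_left h2, standardCoeff]
  simp only [Algebra.smul_def, map_mul, map_pow, map_neg, map_one]
  ring

/-- The periodic complex `⋯ → K[ℤ/2] → K[ℤ/2] → K[ℤ/2]` with the differentials `1 + (-1)^l ϑ`. Its
terms are written as the monoidal unit, so that tensoring with them is the right unitor. -/
noncomputable def standardComplex (K : Type u) [CommRing K] :
    ChainComplex (ModuleCat.{u} (MonoidAlgebra K G2)) ℕ where
  X _ := 𝟙_ _
  d l l' := if l' + 1 = l then standardCoeff K l • 𝟙 _ else 0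
  shape l l' h := if_neg h
  d_comp_d' l l' l'' h h' := by
    simp only [ComplexShape.down_Rel] at h h'
    subst h'
    subst h
    rw [if_pos rfl, if_pos rfl, Linear.smul_comp, Linear.comp_smul, smul_smul, mul_comm,
      standardCoeff_mul, zero_smul]

/-- The augmentation `K[ℤ/2] → K`, `1, ϑ ↦ 1`. -/
noncomputable def augmentation (K : Type u) [CommRing K] :
    𝟙_ (ModuleCat.{u} (MonoidAlgebra K G2)) ⟶ trivialModule K :=
  ModuleCat.ofHom (LinearMap.toSpanSingleton (MonoidAlgebra K G2)
    (Representation.trivial K G2 K).asModule ((Representation.trivial K G2 K).asModuleEquiv.symm 1))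

theorem augmentation_apply (a b : K) :
    (augmentation K).hom (a • 1 + b • MonoidAlgebra.of K G2 (Multiplicative.ofAdd 1) :
      MonoidAlgebra K G2) = (Representation.trivial K G2 K).asModuleEquiv.symm (a + b) := by
  change (a • 1 + b • MonoidAlgebra.of K G2 (Multiplicative.ofAdd 1) : MonoidAlgebra K G2) •
    (Representation.trivial K G2 K).asModuleEquiv.symm 1 = _
  apply (Representation.trivial K G2 K).asModuleEquiv.injective
  rw [Representation.asModuleEquiv_map_smul]
  simp

theorem augmentation_surjective : Function.Surjective (augmentation K).hom := fun x => by
  have h := augmentation_apply (K := K) ((Representation.trivial K G2 K).asModuleEquiv x) 0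
  rw [zero_smul, add_zero, add_zero] at h
  exact ⟨_, h.trans (LinearEquiv.symm_apply_apply _ x)⟩

theorem exists_standardCoeff_one_mul_of_augmentation_eq_zero (x : MonoidAlgebra K G2)
    (hx : (augmentation K).hom x = 0) :
    ∃ y, standardCoeff K 1 * y = x := by
  obtain ⟨a, b, rfl⟩ := exists_eq_add_theta x
  rw [augmentation_apply] at hx
  have h : a + b = 0 := (Representation.trivial K G2 K).asModuleEquiv.symm.injective
    (hx.trans (map_zero _).symm)
  refine ⟨a • 1, ?_⟩
  rw [eq_neg_of_add_eq_zero_right h, standardCoeff]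
  simp only [Algebra.smul_def, map_neg]
  ring

theorem standardComplex_d (K : Type u) [CommRing K] (l : ℕ) :
    (standardComplex K).d (l + 1) l = standardCoeff K (l + 1) • 𝟙 _ := if_pos rfl

theorem standardComplex_exactAt (K : Type u) [CommRing K] (l : ℕ) :
    (standardComplex K).ExactAt (l + 1) := by
  rw [HomologicalComplex.exactAt_iff' _ (l + 2) (l + 1) l (by simp) (by simp),
    ShortComplex.moduleCat_exact_iff]
  intro x hx
  change (ConcreteCategory.hom ((standardComplex K).d (l + 1) l)) x = 0 at hx
  rw [standardComplex_d] at hx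
  obtain ⟨y, hy⟩ := exists_standardCoeff_mul (l + 1) (x := x) hx
  refine ⟨y, ?_⟩
  change (ConcreteCategory.hom ((standardComplex K).d (l + 2) (l + 1))) y = x
  rw [standardComplex_d]
  exact hy

theorem augmentation_standardCoeff_mul (x : MonoidAlgebra K G2) :
    (augmentation K).hom (standardCoeff K 1 * x) = 0 := by
  have h : standardCoeff K 1 = (1 : K) • (1 : MonoidAlgebra K G2) +
      (-1 : K) • MonoidAlgebra.of K G2 (Multiplicative.ofAdd 1) := by
    rw [standardCoeff]; simp
  have h' : (augmentation K).hom (standardCoeff K 1) = 0 := by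
    rw [h, augmentation_apply, add_neg_cancel, map_zero]
    rfl
  rw [mul_comm]
  refine ((augmentation K).hom.map_smul x (standardCoeff K 1)).trans ?_
  rw [h', smul_zero]

theorem standardComplex_d_augmentation (K : Type u) [CommRing K] :
    (standardComplex K).d 1 0 ≫ augmentation K = 0 := by
  rw [standardComplex_d]
  exact ModuleCat.hom_ext (LinearMap.ext augmentation_standardCoeff_mul)

/-- The periodic complex as a projective resolution of the trivial module. -/
noncomputable def standardResolution (K : Type u) [CommRing K] :
    ProjectiveResolution (trivialModule K) where
  complex := standardComplex K
  projective l := inferInstanceAs (Projective (𝟙_ (ModuleCat.{u} (MonoidAlgebra K G2))))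
  π := ((standardComplex K).toSingle₀Equiv (trivialModule K)).symm
    ⟨augmentation K, standardComplex_d_augmentation K⟩
  quasiIso := by
    refine ⟨fun l => ?_⟩
    cases l with
    | zero =>
      rw [ChainComplex.quasiIsoAt₀_iff, ShortComplex.quasiIso_iff_of_zeros' _ rfl rfl rfl]
      constructor
      · rw [ShortComplex.moduleCat_exact_iff]
        intro x hx
        obtain ⟨y, hy⟩ := exists_standardCoeff_one_mul_of_augmentation_eq_zero x hx
        refine ⟨y, ?_⟩
        change (ConcreteCategory.hom ((standardComplex K).d 1 0)) y = x
        rw [standardComplex_d]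
        exact hy
      · rw [ModuleCat.epi_iff_surjective]
        exact augmentation_surjective
    | succ l =>
      rw [quasiIsoAt_iff_exactAt' (hL := ChainComplex.exactAt_succ_single_obj ..)]
      exact standardComplex_exactAt K l

/-! ### Comparison with hyperhomology -/

/-- The right unitors `C_p ⊗ K[ℤ/2] ≅ C_p` identify the bicomplex of `C ⊗ standardComplex K` with the
bicomplex that defines dihedral homology. -/
noncomputable def standardBicomplexIso (C : ChainComplex (ModuleCat.{u} (MonoidAlgebra K G2)) ℕ) :
    (((curriedTensor _).mapBifunctorHomologicalComplex _ _).obj C).obj (standardComplex K) ≅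
      standardBicomplex C :=
  HomologicalComplex.Hom.isoOfComponents
    (fun p => HomologicalComplex.Hom.isoOfComponents (fun l => ρ_ (C.X p)) (by
      intro l l' h
      change (ρ_ (C.X p)).hom ≫ (if l' + 1 = l then standardCoeff K l • 𝟙 _ else 0) =
        (C.X p ◁ (if l' + 1 = l then standardCoeff K l • 𝟙 _ else 0)) ≫ (ρ_ _).hom
      simp only [ComplexShape.down_Rel] at h
      rw [if_pos h, if_pos h, MonoidalLinear.whiskerLeft_smul, MonoidalCategory.whiskerLeft_id,
        Linear.smul_comp, Linear.comp_smul, Category.comp_id, Category.id_comp]))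
    (fun p p' _ => HomologicalComplex.hom_ext _ _ fun l =>
      (rightUnitor_naturality (C.d p p')).symm)

theorem standardBicomplexIso_naturality
    {C C' : ChainComplex (ModuleCat.{u} (MonoidAlgebra K G2)) ℕ} (φ : C ⟶ C') :
    (((curriedTensor _).mapBifunctorHomologicalComplex _ _).map φ).app (standardComplex K) ≫
        (standardBicomplexIso C').hom = (standardBicomplexIso C).hom ≫ standardBicomplexMap φ :=
  HomologicalComplex.hom_ext _ _ fun p => HomologicalComplex.hom_ext _ _ fun _ =>
    rightUnitor_naturality (φ.f p)

/-- Homotopic chain maps induce the same map of graded homology modules. -/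
theorem gradedHomology_map_eq {C D : ChainComplex (ModuleCat.{u} (MonoidAlgebra K G2)) ℕ}
    {φ ψ : C ⟶ D} (h : Homotopy φ ψ) : (gradedHomology K).map φ = (gradedHomology K).map ψ := by
  funext i
  exact (Functor.mapHomotopy _ h).homologyMap_eq i

theorem gradedHomology_map_whiskerRight_eq
    {C D : ChainComplex (ModuleCat.{u} (MonoidAlgebra K G2)) ℕ}
    {φ ψ : C ⟶ D} (h : Homotopy φ ψ) (E : ChainComplex (ModuleCat.{u} (MonoidAlgebra K G2)) ℕ) :
    (gradedHomology K).map (φ ▷ E) = (gradedHomology K).map (ψ ▷ E) :=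
  gradedHomology_map_eq (HomologicalComplex.mapBifunctorMapHomotopy₁ h (𝟙 E) _ _)

theorem gradedHomology_map_whiskerLeft_eq
    {C D : ChainComplex (ModuleCat.{u} (MonoidAlgebra K G2)) ℕ}
    {φ ψ : C ⟶ D} (h : Homotopy φ ψ) (E : ChainComplex (ModuleCat.{u} (MonoidAlgebra K G2)) ℕ) :
    (gradedHomology K).map (E ◁ φ) = (gradedHomology K).map (E ◁ ψ) :=
  gradedHomology_map_eq (HomologicalComplex.mapBifunctorMapHomotopy₂ (𝟙 E) h _ _)

/-- The homology of `E ⊗ P` only depends on the homotopy type of `P`. -/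
noncomputable def homologyTensorIso (E : ChainComplex (ModuleCat.{u} (MonoidAlgebra K G2)) ℕ)
    {P Q : ChainComplex (ModuleCat.{u} (MonoidAlgebra K G2)) ℕ} (e : HomotopyEquiv P Q) :
    (gradedHomology K).obj (E ⊗ P) ≅ (gradedHomology K).obj (E ⊗ Q) where
  hom := (gradedHomology K).map (E ◁ e.hom)
  inv := (gradedHomology K).map (E ◁ e.inv)
  hom_inv_id := by
    rw [← Functor.map_comp, ← MonoidalCategory.whiskerLeft_comp,
      gradedHomology_map_whiskerLeft_eq e.homotopyHomInvId,
      MonoidalCategory.whiskerLeft_id, CategoryTheory.Functor.map_id]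
  inv_hom_id := by
    rw [← Functor.map_comp, ← MonoidalCategory.whiskerLeft_comp,
      gradedHomology_map_whiskerLeft_eq e.homotopyInvHomId,
      MonoidalCategory.whiskerLeft_id, CategoryTheory.Functor.map_id]

/-- The total complex of the bicomplex `standardBicomplex C` is `C ⊗ standardComplex K`. -/
noncomputable def standardTotalIso (C : ChainComplex (ModuleCat.{u} (MonoidAlgebra K G2)) ℕ) :
    (standardBicomplex C).total (ComplexShape.down ℕ) ≅ C ⊗ standardComplex K :=
  (HomologicalComplex₂.total.mapIso (standardBicomplexIso C) (ComplexShape.down ℕ)).symm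

theorem standardTotalIso_naturality {C C' : ChainComplex (ModuleCat.{u} (MonoidAlgebra K G2)) ℕ}
    (φ : C ⟶ C') :
    HomologicalComplex₂.total.map (standardBicomplexMap φ) (ComplexShape.down ℕ) ≫
        (standardTotalIso C').hom = (standardTotalIso C).hom ≫ φ ▷ standardComplex K := by
  -- `φ ▷ _` is defined through `total.map (_ ≫ _)` whose second factor comes from an identity map.
  have e : φ ▷ standardComplex K = HomologicalComplex₂.total.map
      ((((curriedTensor _).mapBifunctorHomologicalComplex _ _).map φ).app (standardComplex K))
      (ComplexShape.down ℕ) :=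
    congrArg (HomologicalComplex₂.total.map · (ComplexShape.down ℕ))
      ((congrArg _ (CategoryTheory.Functor.map_id _ _)).trans (Category.comp_id _))
  rw [← Iso.inv_comp_eq, ← Category.assoc, ← Iso.eq_comp_inv, e]
  refine (HomologicalComplex₂.total.map_comp _ _ _).symm.trans (Eq.trans ?_
    (HomologicalComplex₂.total.map_comp _ _ _))
  rw [standardBicomplexIso_naturality]

/-- The isomorphism between dihedral homology and hyperhomology: dihedral homology is hyperhomology
for the periodic resolution, and any two resolutions are homotopy equivalent. -/
noncomputable def dihedralHomologyIso (P : ProjectiveResolution (trivialModule K))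
    (X : DFModule.{u} K) :
    dihedralHomology X ≅ (hyperhomology P).obj (cyclicBicomplex X) :=
  (gradedHomology K).mapIso (standardTotalIso _) ≪≫
    homologyTensorIso _ (ProjectiveResolution.homotopyEquiv (standardResolution K) P)

theorem dihedralHomologyIso_naturality (P : ProjectiveResolution (trivialModule K))
    {X Y : DFModule.{u} K} (f : X ⟶ Y) :
    dihedralHomologyMap f ≫ (dihedralHomologyIso P Y).hom =
      (dihedralHomologyIso P X).hom ≫ (hyperhomology P).map (cyclicBicomplexMap f) := by
  set φ := HomologicalComplex₂.total.map (cyclicBicomplexMap f) (ComplexShape.down ℕ) with hφ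
  set e : HomotopyEquiv (standardComplex K) P.complex :=
    ProjectiveResolution.homotopyEquiv (standardResolution K) P
  have h1 : dihedralHomologyMap f ≫ (dihedralHomologyIso P Y).hom =
    (gradedHomology K).map (HomologicalComplex₂.total.map (standardBicomplexMap φ) _ ≫
      (standardTotalIso _).hom ≫ _ ◁ e.hom) := by
    rw [CategoryTheory.Functor.map_comp, CategoryTheory.Functor.map_comp]
    rfl
  have h2 : (dihedralHomologyIso P X).hom ≫ (hyperhomology P).map (cyclicBicomplexMap f) =
    (gradedHomology K).map ((standardTotalIso _).hom ≫ _ ◁ e.hom ≫ φ ▷ P.complex) := by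
    rw [CategoryTheory.Functor.map_comp, CategoryTheory.Functor.map_comp]
    rfl
  rw [h1, h2, whisker_exchange, ← Category.assoc, standardTotalIso_naturality, Category.assoc]

/-- Homotopic morphisms induce the same map of dihedral homology. -/
theorem dihedralHomologyMap_eq {X Y : DFModule.{u} K} {f g : X ⟶ Y} (h : DFModule.Homotopy f g) :
    dihedralHomologyMap f = dihedralHomologyMap g := by
  have e : (hyperhomology (standardResolution K)).map (cyclicBicomplexMap f) =
      (hyperhomology (standardResolution K)).map (cyclicBicomplexMap g) :=
    gradedHomology_map_whiskerRight_eq (totalCyclicHomotopy h) _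
  rw [← cancel_mono (dihedralHomologyIso (standardResolution K) Y).hom,
    dihedralHomologyIso_naturality, dihedralHomologyIso_naturality, e]

theorem isIso_map_of_isHomotopyEquivalence {X Y : DFModule.{u} K} {f : X ⟶ Y}
    (hf : DFModule.IsHomotopyEquivalence f) : IsIso ((dihedralHomologyFunctor K).map f) := by
  obtain ⟨g, ⟨h⟩, ⟨h'⟩⟩ := hf
  refine ⟨(dihedralHomologyFunctor K).map g, ?_, ?_⟩
  · rw [← Functor.map_comp, ← CategoryTheory.Functor.map_id]
    exact dihedralHomologyMap_eq h
  · rw [← Functor.map_comp, ← CategoryTheory.Functor.map_id]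
    exact dihedralHomologyMap_eq h'

end Dihedral

theorem theorem2p1 (K : Type u) [CommRing K] :
    ∃ (HD : Dihedral.DFModule.{u} K ⥤ GradedObject ℕ (ModuleCat.{u} K))
      (hobj : ∀ X : Dihedral.DFModule.{u} K, HD.obj X = Dihedral.dihedralHomology X),
      (∀ (X Y : Dihedral.DFModule.{u} K) (f : X ⟶ Y),
        HD.map f = eqToHom (hobj X) ≫ Dihedral.dihedralHomologyMap f ≫ eqToHom (hobj Y).symm) ∧
      (∀ P : ProjectiveResolution (Dihedral.trivialModule K),
        ∃ e : ∀ X : Dihedral.DFModule.{u} K,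
            HD.obj X ≅ (Dihedral.hyperhomology P).obj (Dihedral.cyclicBicomplex X),
          ∀ (X Y : Dihedral.DFModule.{u} K) (f : X ⟶ Y),
            HD.map f ≫ (e Y).hom =
              (e X).hom ≫ (Dihedral.hyperhomology P).map (Dihedral.cyclicBicomplexMap f)) ∧
      (∀ (X Y : Dihedral.DFModule.{u} K) (f : X ⟶ Y),
        Dihedral.DFModule.IsHomotopyEquivalence f → IsIso (HD.map f)) := by
  refine ⟨Dihedral.dihedralHomologyFunctor K, fun _ => rfl, fun X Y f => ?_, fun P =>
    ⟨Dihedral.dihedralHomologyIso P, fun X Y f => Dihedral.dihedralHomologyIso_naturality P f⟩,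
    fun X Y f => Dihedral.isIso_map_of_isHomotopyEquivalence⟩
  exact ((Category.id_comp _).trans (Category.comp_id _)).symm
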